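/- \textbf{Definitions.} Write $\{0,1\}^n$ for the Boolean cube and $N=2^n$. For $f,g:\{0,1\}^n\to\{-1,1\}$ let $$\Phi_{f,g}=\frac{1}{2^{3n/2}}\sum_{x,y\in\{0,1\}^n} f(x)\,(-1)^{x\cdot y}\,g(y).$$ The partial Boolean function $\mathsf{For}_n$ takes as input the $2N$ bits of the truth tables of $f$ and $g$ (a value $s\in\{-1,1\}$ being encoded by the bit $(1+s)/2$). It equals $1$ if $\Phi_{f,g}\ge 0.07$, equals $0$ if $|\Phi_{f,g}|\le 0.01$, and is undefined otherwise. A $\mathsf{BPP_{path}}$ query algorithm $A$ on $M$-bit inputs is a randomized query algorithm, that is, a probability distribution over deterministic decision trees that adaptively query bits of the input $z\in\{0,1\}^M$, in which every run ends by failing, accepting or rejecting; the run succeeds if it accepts or rejects. It makes at most $q$ queries if each decision tree in the support of the distribution has depth at most $q$. It computes a partial function $F:D\to\{0,1\}$, $D\subseteq\{0,1\}^M$, if for every $z\in D$: (i) $\Pr[A(z)\text{ succeeds}]>0$; (ii) if $F(z)=1$ then $\Pr[A(z)\text{ accepts}\mid A(z)\text{ succeeds}]\ge \frac23$; (iii)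 if $F(z)=0$ then $\Pr[A(z)\text{ accepts}\mid A(z)\text{ succeeds}]\le\frac13$. \textbf{Theorem.} No $\mathsf{BPP_{path}}$ query algorithm computes $\mathsf{For}_n$ with $\operatorname{poly}(n)$ queries. Precisely: for every polynomial $p$ with coefficients in $\mathbb{N}$ there is an $n_0$ such that for all $n\ge n_0$ there is no $\mathsf{BPP_{path}}$ query algorithm that makes at most $p(n)$ queries and computes $\mathsf{For}_n$. -/

import Mathlib

open scoped ENNReal

/-- The result of a run: fail, or succeed and then either accept or reject. -/
inductive PathOutcome where
  | fail : PathOutcome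
  | accept : PathOutcome
  | reject : PathOutcome

/-- Deterministic (adaptive) query algorithms on inputs `z : ι → Bool`, i.e. decision trees.
`query i t₀ t₁` reads the bit `z i` and continues with `t₀` if it is `false`, and with `t₁` if it
is `true`. -/
inductive QueryTree (ι : Type) where
  | leaf : PathOutcome → QueryTree ι
  | query : ι → QueryTree ι → QueryTree ι → QueryTree ι

namespace QueryTree

variable {ι : Type}

/-- The outcome of the tree on the input `z`. -/
def run (z : ι → Bool) : QueryTree ι → PathOutcome
  | leaf o => o
  | query i t₀ t₁ => if z i then run z t₁ else run z t₀

/-- The worst-case number of queries. -/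
def depth : QueryTree ι → ℕ
  | leaf _ => 0
  | query _ t₀ t₁ => max (depth t₀) (depth t₁) + 1

end QueryTree

/-- A `BPP_path` query algorithm: a randomized query algorithm (a probability distribution on
deterministic ones) whose runs fail, accept or reject. -/
abbrev BPPPathAlgorithm (ι : Type) := PMF (QueryTree ι)

namespace BPPPathAlgorithm

variable {ι : Type}

/-- Every run, whatever the coin flips and the input, makes at most `q` queries. -/
def MakesAtMost (A : BPPPathAlgorithm ι) (q : ℕ) : Prop :=
  ∀ t ∈ A.support, t.depth ≤ q

/-- The probability that `A` has outcome `o` on the input `z`. -/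
noncomputable def prob (A : BPPPathAlgorithm ι) (z : ι → Bool) (o : PathOutcome) : ℝ≥0∞ :=
  A.map (QueryTree.run z) o

/-- `Pr[A(z) succeeds]`. -/
noncomputable def succeedProb (A : BPPPathAlgorithm ι) (z : ι → Bool) : ℝ≥0∞ :=
  A.prob z .accept + A.prob z .reject

/-- `Pr[A(z) accepts | A(z) succeeds]`, meaningful when `Pr[A(z) succeeds] > 0`. -/
noncomputable def acceptProbGivenSucceed (A : BPPPathAlgorithm ι) (z : ι → Bool) : ℝ≥0∞ :=
  A.prob z .accept / A.succeedProb z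

/-- `A` computes the partial Boolean function `F` (`F z = none` outside the domain of `F`). Nothing
is required of `A` on inputs outside the domain. -/
def Computes (A : BPPPathAlgorithm ι) (F : (ι → Bool) → Option Bool) : Prop :=
  (∀ z, F z ≠ none → 0 < A.succeedProb z) ∧
  (∀ z, F z = some true → 2 / 3 ≤ A.acceptProbGivenSucceed z) ∧
  (∀ z, F z = some false → A.acceptProbGivenSucceed z ≤ 1 / 3)

end BPPPathAlgorithm

/-- `Φ_{f,g} = 2^{-3n/2} ∑_{x,y} f(x) (-1)^{x·y} g(y)`. -/
noncomputable def forrelation (n : ℕ) (f g : (Fin n → Bool) → ℤˣ) : ℝ :=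
  1 / (2 : ℝ) ^ (3 * (n : ℝ) / 2) *
    ∑ x : Fin n → Bool, ∑ y : Fin n → Bool,
      ((f x : ℤ) : ℝ) * (-1) ^ (∑ i, (x i).toNat * (y i).toNat) * ((g y : ℤ) : ℝ)

/-- The identification of `{0,1}` with `{-1,1}` inverse to `s ↦ (1 + s) / 2`. -/
def bitSign (b : Bool) : ℤˣ := if b then 1 else -1

/-- The positions of the `2 · 2^n` input bits of `For_n`: the truth table of `f` followed by the
truth table of `g`. -/
abbrev ForIndex (n : ℕ) := (Fin n → Bool) ⊕ (Fin n → Bool)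

/-- The partial function `For_n`. -/
noncomputable def For (n : ℕ) (z : ForIndex n → Bool) : Option Bool :=
  let Φ := forrelation n (fun x => bitSign (z (.inl x))) (fun y => bitSign (z (.inr y)))
  if 0.07 ≤ Φ then some true
  else if |Φ| ≤ 0.01 then some false
  else none

/-! Write N = 2^n. Conditioning on success can magnify events of tiny probability, so additive
indistinguishability of two input distributions is useless here; what is needed is a multiplicative
comparison. If two weights, one on 0-inputs and one on 1-inputs, have a ratio in [c₁, c₂] on every
subcube of codimension at most q, with c₂ < 4c₁, then no algorithm with q queries works: an outcome
event of a tree is a disjoint union of such subcubes, and the factors 2 gained on 1-inputs and on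
0-inputs multiply to 4 (`not_computes_of_subcube_ratio`).

On the 0-side the weight is uniform, cut down to small Φ. Since Φ has second moment 1/N and hardly
moves when few bits change, the cut costs little in any such subcube (`le_sum_uniformWeight`).

On the 1-side, f and g are the signs of v and Hv, for v standard Gaussian in ℝ^N and H the
normalised Hadamard matrix, cut down to large Φ. Any Q of these 2N linear forms have covariance
within ε = Q/√N of the identity, so their joint law agrees with an isotropic Gaussian up to a factor
((1+ε)/(1-ε))^Q, which is close to 1 (`gaussianPi_sandwich`, `forForms_sandwich`). Hence every
subcube of codimension k ≤ Q has mass about 2^{-k}.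

It remains that Φ is large with constant probability inside each subcube. Since H is an orthogonal
involution, Φ < 0.07 forces the sum of (1 - (4/5)|t|)^2 over all 2N forms t to be at least 0.93 N
(`le_sum_signLoss`), whereas its mean is below 0.77 N. Markov's inequality for the square of this
sum involves only two forms beyond the queried ones, so the sandwich still applies and bounds the
bad part by 0.69 · 2^{-k} (`measure_subcube_bitForrelation_lt`). This leaves ratios between 0.29 and
1.03, and 1.03 < 4 · 0.29. -/

/-! ### Decision trees and subcubes -/

namespace QueryTree

variable {ι : Type}

/-- If `w` is dominated by `w'` on all subcubes of codimension at most `q`, then it is dominated on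
every outcome event of a decision tree of depth at most `q`. -/
theorem sum_run_le [Fintype ι] [DecidableEq ι] [DecidableEq PathOutcome] {q : ℕ}
    {w w' : (ι → Bool) → ℝ≥0∞}
    (h : ∀ K : Finset ι, K.card ≤ q → ∀ s : ι → Bool,
      ∑ z with (∀ i ∈ K, z i = s i), w z ≤ ∑ z with (∀ i ∈ K, z i = s i), w' z)
    (o : PathOutcome) (t : QueryTree ι) :
    ∀ (K : Finset ι) (s : ι → Bool), K.card + t.depth ≤ q →
      ∑ z with ((∀ i ∈ K, z i = s i) ∧ t.run z = o), w z ≤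
        ∑ z with ((∀ i ∈ K, z i = s i) ∧ t.run z = o), w' z := by
  induction t with
  | leaf o' =>
    intro K s hK
    by_cases ho : o' = o
    · simpa [run, ho] using h K (by simpa [depth] using hK) s
    · simp [run, ho]
  | query i t₀ t₁ ih₀ ih₁ =>
    intro K s hK
    simp only [depth] at hK
    -- A repeated query imposes no new constraint. A fresh one splits the subcube in two, and the
    -- extra codimension is paid for by the drop in depth.
    by_cases hi : i ∈ K
    · have key : ∀ z : ι → Bool, ((∀ j ∈ K, z j = s j) ∧ (query i t₀ t₁).run z = o) ↔
          ((∀ j ∈ K, z j = s j) ∧ (if s i then t₁ else t₀).run z = o) := by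
        intro z
        refine and_congr_right fun hz => ?_
        simp only [run, hz i hi]
        split_ifs <;> rfl
      simp only [key]
      split_ifs
      · exact ih₁ K s (by omega)
      · exact ih₀ K s (by omega)
    · have key : ∀ u : (ι → Bool) → ℝ≥0∞,
          ∑ z with ((∀ j ∈ K, z j = s j) ∧ (query i t₀ t₁).run z = o), u z =
          ∑ z with ((∀ j ∈ insert i K, z j = Function.update s i true j) ∧ t₁.run z = o), u z +
          ∑ z with ((∀ j ∈ insert i K, z j = Function.update s i false j) ∧ t₀.run z = o), u z := by
        intro u
        rw [← Finset.sum_union]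
        · refine Finset.sum_congr ?_ fun _ _ => rfl
          ext z
          have hu : ∀ b, (∀ j ∈ insert i K, z j = Function.update s i b j) ↔
              (z i = b ∧ ∀ j ∈ K, z j = s j) := by
            intro b
            rw [Finset.forall_mem_insert, Function.update_self]
            refine and_congr_right fun _ => forall₂_congr fun j hj => ?_
            rw [Function.update_of_ne (ne_of_mem_of_not_mem hj hi)]
          rw [Finset.mem_union, Finset.mem_filter, Finset.mem_filter, Finset.mem_filter, hu, hu, run]
          cases z i <;> simp
        · rw [Finset.disjoint_filter]
          rintro z - h₁ h₂
          have e₁ := h₁.1 i (Finset.mem_insert_self _ _)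
          have e₂ := h₂.1 i (Finset.mem_insert_self _ _)
          rw [Function.update_self] at e₁ e₂
          simp [e₁] at e₂
      rw [key, key]
      have hc := Finset.card_insert_of_notMem hi
      exact add_le_add (ih₁ _ _ (by omega)) (ih₀ _ _ (by omega))

end QueryTree

/-! ### Averaging a randomized algorithm against two weights -/

namespace BPPPathAlgorithm

variable {ι : Type}

theorem prob_eq_tsum (A : BPPPathAlgorithm ι) (z : ι → Bool) (o : PathOutcome)
    [DecidableEq PathOutcome] :
    A.prob z o = ∑' t, if t.run z = o then A t else 0 := by
  simp only [prob, PMF.map_apply]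
  refine tsum_congr fun t => ?_
  by_cases h : t.run z = o
  · rw [if_pos h, if_pos h.symm]
  · rw [if_neg h, if_neg (Ne.symm h)]

theorem prob_le_one (A : BPPPathAlgorithm ι) (z : ι → Bool) (o : PathOutcome) : A.prob z o ≤ 1 :=
  PMF.coe_le_one _ _

theorem prob_ne_top (A : BPPPathAlgorithm ι) (z : ι → Bool) (o : PathOutcome) : A.prob z o ≠ ∞ :=
  ne_top_of_le_ne_top ENNReal.one_ne_top (A.prob_le_one z o)

theorem sum_mul_prob_le [Fintype ι] [DecidableEq ι] {A : BPPPathAlgorithm ι} {q : ℕ}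
    (hA : A.MakesAtMost q) {w w' : (ι → Bool) → ℝ≥0∞}
    (h : ∀ K : Finset ι, K.card ≤ q → ∀ s : ι → Bool,
      ∑ z with (∀ i ∈ K, z i = s i), w z ≤ ∑ z with (∀ i ∈ K, z i = s i), w' z)
    (o : PathOutcome) :
    ∑ z, w z * A.prob z o ≤ ∑ z, w' z * A.prob z o := by
  classical
  have key : ∀ u : (ι → Bool) → ℝ≥0∞,
      ∑ z, u z * A.prob z o = ∑' t, A t * ∑ z with t.run z = o, u z := by
    intro u
    simp only [prob_eq_tsum, ← ENNReal.tsum_mul_left]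
    rw [← Summable.tsum_finsetSum fun _ _ => ENNReal.summable]
    refine tsum_congr fun t => ?_
    rw [Finset.mul_sum, Finset.sum_filter]
    refine Finset.sum_congr rfl fun z _ => ?_
    split_ifs <;> simp [mul_comm]
  rw [key, key]
  refine ENNReal.tsum_le_tsum fun t => ?_
  by_cases ht : t ∈ A.support
  · have := QueryTree.sum_run_le h o t ∅ (fun _ => true) (by simpa using hA t ht)
    simp only [Finset.notMem_empty, false_imp_iff, implies_true, true_and] at this
    gcongr
  · rw [PMF.mem_support_iff, not_not] at ht
    simp [ht]

/-- Clearing the denominator makes the condition linear in the outcome probabilities, so that it can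
be summed over inputs although the success probability varies with the input. -/
theorem Computes.two_mul_reject_le {A : BPPPathAlgorithm ι} {F : (ι → Bool) → Option Bool}
    (hA : A.Computes F) {z : ι → Bool} (hz : F z = some true) :
    2 * A.prob z .reject ≤ A.prob z .accept := by
  have h0 := hA.1 z (by simp [hz])
  have h1 := hA.2.1 z hz
  have ha := A.prob_ne_top z .accept
  have hr := A.prob_ne_top z .reject
  unfold acceptProbGivenSucceed at h1
  unfold succeedProb at h0 h1
  rw [ENNReal.le_div_iff_mul_le (Or.inl h0.ne') (Or.inl (ENNReal.add_ne_top.2 ⟨ha, hr⟩))] at h1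
  lift A.prob z .accept to NNReal using ha with a
  lift A.prob z .reject to NNReal using hr with r
  have h2 := ENNReal.toReal_mono (by simp) h1
  rw [← ENNReal.toReal_le_toReal (by finiteness) (by finiteness)]
  simp [ENNReal.toReal_add] at h2 ⊢
  linarith

theorem Computes.two_mul_accept_le {A : BPPPathAlgorithm ι} {F : (ι → Bool) → Option Bool}
    (hA : A.Computes F) {z : ι → Bool} (hz : F z = some false) :
    2 * A.prob z .accept ≤ A.prob z .reject := by
  have h0 := hA.1 z (by simp [hz])
  have h1 := hA.2.2 z hz
  have ha := A.prob_ne_top z .accept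
  have hr := A.prob_ne_top z .reject
  unfold acceptProbGivenSucceed at h1
  unfold succeedProb at h0 h1
  rw [ENNReal.div_le_iff_le_mul (Or.inl h0.ne') (Or.inl (ENNReal.add_ne_top.2 ⟨ha, hr⟩))] at h1
  lift A.prob z .accept to NNReal using ha with a
  lift A.prob z .reject to NNReal using hr with r
  have h2 := ENNReal.toReal_mono (by finiteness) h1
  rw [← ENNReal.toReal_le_toReal (by finiteness) (by finiteness)]
  simp [ENNReal.toReal_add] at h2 ⊢
  linarith

/-- A `BPP_path` query algorithm with `q` queries cannot separate two weights supported on the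
`1`-inputs and on the `0`-inputs whose ratio on subcubes of codimension at most `q` varies by a
factor less than `4`. -/
theorem not_computes_of_subcube_ratio [Fintype ι] [DecidableEq ι] {A : BPPPathAlgorithm ι} {q : ℕ}
    (hA : A.MakesAtMost q) {F : (ι → Bool) → Option Bool} {w₀ w₁ : (ι → Bool) → ℝ≥0∞}
    (h₀ : ∀ z, w₀ z ≠ 0 → F z = some false) (h₁ : ∀ z, w₁ z ≠ 0 → F z = some true)
    {c₁ c₂ : ℝ≥0∞} (hc : c₂ < 4 * c₁) (hc₁ : c₁ ≠ ∞)
    (hl : ∀ K : Finset ι, K.card ≤ q → ∀ s : ι → Bool,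
      c₁ * ∑ z with (∀ i ∈ K, z i = s i), w₀ z ≤ ∑ z with (∀ i ∈ K, z i = s i), w₁ z)
    (hu : ∀ K : Finset ι, K.card ≤ q → ∀ s : ι → Bool,
      ∑ z with (∀ i ∈ K, z i = s i), w₁ z ≤ c₂ * ∑ z with (∀ i ∈ K, z i = s i), w₀ z)
    (hpos : ∑ z, w₀ z ≠ 0) (hfin : ∑ z, w₀ z ≠ ∞) :
    ¬ A.Computes F := by
  intro hAF
  have hl' := sum_mul_prob_le hA (w := fun z => c₁ * w₀ z) (w' := w₁)
    (fun K hK s => by simpa [Finset.mul_sum] using hl K hK s) .reject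
  have hu' := sum_mul_prob_le hA (w := w₁) (w' := fun z => c₂ * w₀ z)
    (fun K hK s => by simpa [Finset.mul_sum] using hu K hK s) .accept
  simp only [mul_assoc, ← Finset.mul_sum] at hl' hu'
  have e₁ : 2 * ∑ z, w₁ z * A.prob z .reject ≤ ∑ z, w₁ z * A.prob z .accept := by
    rw [Finset.mul_sum]
    refine Finset.sum_le_sum fun z _ => ?_
    by_cases hz : w₁ z = 0
    · simp [hz]
    · rw [mul_left_comm]
      gcongr
      exact hAF.two_mul_reject_le (h₁ z hz)
  have e₀ : 2 * ∑ z, w₀ z * A.prob z .accept ≤ ∑ z, w₀ z * A.prob z .reject := by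
    rw [Finset.mul_sum]
    refine Finset.sum_le_sum fun z _ => ?_
    by_cases hz : w₀ z = 0
    · simp [hz]
    · rw [mul_left_comm]
      gcongr
      exact hAF.two_mul_accept_le (h₀ z hz)
  have hle : ∀ o, ∑ z, w₀ z * A.prob z o ≠ ∞ := fun o =>
    ne_top_of_le_ne_top hfin
      (Finset.sum_le_sum fun z _ => mul_le_of_le_one_right' (A.prob_le_one z o))
  set a := ∑ z, w₀ z * A.prob z .accept
  set r := ∑ z, w₀ z * A.prob z .reject
  -- One factor 2 comes from the 0-inputs, the other from the 1-inputs. Rejection is compared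
  -- through `c₁` and acceptance through `c₂`.
  have hchain : 4 * c₁ * a ≤ c₂ * a :=
    calc 4 * c₁ * a = 2 * (c₁ * (2 * a)) := by ring
      _ ≤ 2 * (c₁ * r) := by gcongr
      _ ≤ 2 * ∑ z, w₁ z * A.prob z .reject := by gcongr
      _ ≤ _ := e₁
      _ ≤ _ := hu'
  have ha : a = 0 := by
    by_contra ha
    exact absurd hchain (not_le.2 ((ENNReal.mul_lt_mul_iff_left ha (hle _)).2 hc))
  have hr : r = 0 := by
    have : 2 * (c₁ * r) ≤ 0 := by
      calc 2 * (c₁ * r) ≤ 2 * ∑ z, w₁ z * A.prob z .reject := by gcongr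
        _ ≤ _ := e₁
        _ ≤ _ := hu'
        _ = 0 := by rw [ha, mul_zero]
    have hc0 : c₁ ≠ 0 := by rintro rfl; simp at hc
    simpa [hc0] using this
  -- With `a = r = 0`, the algorithm never succeeds on a 0-input of nonzero weight, so there is
  -- none.
  apply hpos
  refine Finset.sum_eq_zero fun z _ => ?_
  by_contra hz
  have hs := hAF.1 z (by simp [h₀ z hz])
  have ha' := Finset.sum_eq_zero_iff.1 ha z (Finset.mem_univ _)
  have hr' := Finset.sum_eq_zero_iff.1 hr z (Finset.mem_univ _)
  simp only [mul_eq_zero, hz, false_or] at ha' hr'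
  simp [succeedProb, ha', hr'] at hs

end BPPPathAlgorithm

/-! ### Comparison of nearly isotropic Gaussian measures -/

section GaussianSandwich

open MeasureTheory ProbabilityTheory Matrix

theorem lintegral_fin_prod_eq_prod {n : ℕ} {E : Type*} [MeasurableSpace E]
    {μ : Fin n → Measure E} [∀ i, SigmaFinite (μ i)] (f : Fin n → E → ℝ≥0∞)
    (hf : ∀ i, Measurable (f i)) :
    ∫⁻ x, ∏ i, f i (x i) ∂(Measure.pi μ) = ∏ i, ∫⁻ x, f i x ∂(μ i) := by
  induction n with
  | zero => simp
  | succ n ih =>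
    have e := (measurePreserving_piFinSuccAbove μ 0).lintegral_map_equiv
      (fun x : E × (Fin n → E) => f 0 x.1 * ∏ i : Fin n, f i.succ (x.2 i))
    have e' := lintegral_prod_mul (μ := μ 0) (ν := Measure.pi fun j : Fin n => μ j.succ)
      (f := f 0) (g := fun x => ∏ i : Fin n, f i.succ (x i)) (hf 0).aemeasurable
      (Finset.measurable_prod _ fun i _ =>
        (hf i.succ).comp (measurable_pi_apply i)).aemeasurable
    rw [Fin.prod_univ_succ, ← ih (fun i => f i.succ) fun i => hf _, ← e']
    refine Eq.trans (lintegral_congr fun x => ?_) e.symm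
    rw [Fin.prod_univ_succ]
    rfl

theorem lintegral_fintype_prod_eq_prod {ι : Type*} [Fintype ι] {E : Type*} [MeasurableSpace E]
    {μ : ι → Measure E} [∀ i, SigmaFinite (μ i)] (f : ι → E → ℝ≥0∞)
    (hf : ∀ i, Measurable (f i)) :
    ∫⁻ x, ∏ i, f i (x i) ∂(Measure.pi μ) = ∏ i, ∫⁻ x, f i x ∂(μ i) := by
  let e := (Fintype.equivFin ι).symm
  rw [(measurePreserving_piCongrLeft _ e).lintegral_map_equiv]
  simp_rw [← e.prod_comp, MeasurableEquiv.coe_piCongrLeft, Equiv.piCongrLeft_apply_apply]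
  exact lintegral_fin_prod_eq_prod (fun i => f (e i)) fun i => hf _

/-- The standard Gaussian measure on `ℝ^κ`. -/
noncomputable def gaussianPi (κ : Type*) [Fintype κ] : Measure (κ → ℝ) :=
  Measure.pi fun _ => gaussianReal 0 1

instance {κ : Type*} [Fintype κ] : IsProbabilityMeasure (gaussianPi κ) := by
  unfold gaussianPi; infer_instance

variable {κ X : Type*} [Fintype κ] [Fintype X]

theorem gaussianPi_eq_withDensity :
    gaussianPi κ = volume.withDensity fun z => ∏ i, gaussianPDF 0 1 (z i) := by
  refine Measure.pi_eq fun s hs => ?_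
  rw [withDensity_apply _ (MeasurableSet.univ_pi hs),
    ← lintegral_indicator (MeasurableSet.univ_pi hs)]
  have : ∀ z : κ → ℝ, (Set.univ.pi s).indicator (fun z => ∏ i, gaussianPDF 0 1 (z i)) z =
      ∏ i, (s i).indicator (gaussianPDF 0 1) (z i) := by
    intro z
    by_cases hz : z ∈ Set.univ.pi s
    · rw [Set.indicator_of_mem hz]
      exact Finset.prod_congr rfl fun i _ => (Set.indicator_of_mem (hz i trivial) _).symm
    · rw [Set.indicator_of_notMem hz]
      simp only [Set.mem_univ_pi, not_forall] at hz
      obtain ⟨i, hi⟩ := hz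
      exact (Finset.prod_eq_zero (Finset.mem_univ i) (Set.indicator_of_notMem hi _)).symm
  simp_rw [this]
  rw [volume_pi, lintegral_fintype_prod_eq_prod _ fun i =>
    (measurable_gaussianPDF 0 1).indicator (hs i)]
  refine Finset.prod_congr rfl fun i _ => ?_
  rw [lintegral_indicator (hs i), gaussianReal_of_var_ne_zero 0 one_ne_zero,
    withDensity_apply _ (hs i)]

theorem prod_gaussianPDF_le {z z' : κ → ℝ} (h : z' ⬝ᵥ z' ≤ z ⬝ᵥ z) :
    ∏ i, gaussianPDF 0 1 (z i) ≤ ∏ i, gaussianPDF 0 1 (z' i) := by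
  simp only [gaussianPDF, ← ENNReal.ofReal_prod_of_nonneg fun i _ => gaussianPDFReal_nonneg 0 1 _]
  refine ENNReal.ofReal_le_ofReal ?_
  simp only [gaussianPDFReal, Finset.prod_mul_distrib, ← Real.exp_sum]
  refine mul_le_mul_of_nonneg_left (Real.exp_le_exp.2 ?_) (by positivity)
  simp only [sub_zero, NNReal.coe_one, mul_one, ← Finset.sum_div, Finset.sum_neg_distrib]
  simp only [dotProduct, ← sq] at h
  linarith

/-- Substitution u = Pz. Keeping the determinant on the left leaves on the right an unnormalised
density, for which domination of quadratic forms is a pointwise inequality. -/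
theorem lintegral_mulVec_gaussianPi [DecidableEq κ] {P : Matrix κ κ ℝ} (hP : P.det ≠ 0)
    {F : (κ → ℝ) → ℝ≥0∞} (hF : Measurable F) :
    ENNReal.ofReal |P.det| * ∫⁻ z, F (P *ᵥ z) ∂gaussianPi κ =
      ∫⁻ u, F u * ∏ i, gaussianPDF 0 1 ((P⁻¹ *ᵥ u) i) := by
  have hm : ∀ Q : Matrix κ κ ℝ, Measurable fun z : κ → ℝ => Q *ᵥ z := fun Q =>
    (Continuous.matrix_mulVec continuous_const continuous_id).measurable
  have hρ : Measurable fun z : κ → ℝ => ∏ i, gaussianPDF 0 1 (z i) :=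
    Finset.measurable_prod _ fun i _ => (measurable_gaussianPDF 0 1).comp (measurable_pi_apply i)
  have hG : Measurable fun u : κ → ℝ => F u * ∏ i, gaussianPDF 0 1 ((P⁻¹ *ᵥ u) i) :=
    hF.mul (hρ.comp (hm _))
  have hdet : IsUnit P.det := isUnit_iff_ne_zero.2 hP
  have h1 : ∫⁻ z, F (P *ᵥ z) ∂gaussianPi κ =
      ∫⁻ u, F u * ∏ i, gaussianPDF 0 1 ((P⁻¹ *ᵥ u) i) ∂(Measure.map (toLin' P) volume) := by
    have e := lintegral_withDensity_eq_lintegral_mul volume hρ (hF.comp (hm P))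
    simp only [Function.comp_apply] at e
    rw [gaussianPi_eq_withDensity, e, show (toLin' P : (κ → ℝ) → κ → ℝ) = fun z => P *ᵥ z from rfl,
      lintegral_map hG (hm P)]
    refine lintegral_congr fun z => ?_
    simp [mul_comm, Matrix.mulVec_mulVec, nonsing_inv_mul P hdet]
  rw [h1, Real.map_matrix_volume_pi_eq_smul_volume_pi hP, lintegral_smul_measure, smul_eq_mul,
    ← mul_assoc, ← ENNReal.ofReal_mul (abs_nonneg _), ← abs_mul, mul_inv_cancel₀ hP]
  simp

/-- Comparison of two centred nondegenerate Gaussian measures, one of whose quadratic forms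
dominates the other. -/
theorem lintegral_mulVec_gaussianPi_le [DecidableEq κ] {P Q : Matrix κ κ ℝ} (hP : P.det ≠ 0)
    (hQ : Q.det ≠ 0) (h : ∀ z z', P *ᵥ z = Q *ᵥ z' → z' ⬝ᵥ z' ≤ z ⬝ᵥ z)
    {F : (κ → ℝ) → ℝ≥0∞} (hF : Measurable F) :
    ENNReal.ofReal |P.det| * ∫⁻ z, F (P *ᵥ z) ∂gaussianPi κ ≤
      ENNReal.ofReal |Q.det| * ∫⁻ z, F (Q *ᵥ z) ∂gaussianPi κ := by
  rw [lintegral_mulVec_gaussianPi hP hF, lintegral_mulVec_gaussianPi hQ hF]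
  refine lintegral_mono fun u => ?_
  refine mul_le_mul_right ?_ _
  refine prod_gaussianPDF_le (h _ _ ?_)
  rw [Matrix.mulVec_mulVec, Matrix.mulVec_mulVec, mul_nonsing_inv P (isUnit_iff_ne_zero.2 hP),
    mul_nonsing_inv Q (isUnit_iff_ne_zero.2 hQ)]

theorem charFunDual_gaussianPi (l : StrongDual ℝ (X → ℝ)) (d : X → ℝ)
    (hl : ∀ v, l v = d ⬝ᵥ v) :
    charFunDual (gaussianPi X) l = Complex.exp (-((d ⬝ᵥ d : ℝ) : ℂ) / 2) := by
  rw [charFunDual_apply, gaussianPi]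
  simp only [hl, dotProduct, Complex.ofReal_sum, Finset.sum_mul, Complex.exp_sum,
    Complex.ofReal_mul]
  rw [integral_fintype_prod_eq_prod (fun i (x : ℝ) => Complex.exp ((d i : ℂ) * (x : ℂ) * Complex.I))]
  simp only [← charFun_apply_real, charFun_gaussianReal]
  rw [← Complex.exp_sum]
  simp [Finset.sum_div, Finset.sum_neg_distrib, neg_div, sq]

theorem measurable_mulVec (B : Matrix κ X ℝ) : Measurable fun v : X → ℝ => B *ᵥ v :=
  (Continuous.matrix_mulVec continuous_const continuous_id).measurable

theorem charFunDual_map_mulVec_gaussianPi [DecidableEq κ] (B : Matrix κ X ℝ)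
    (l : StrongDual ℝ (κ → ℝ)) (c : κ → ℝ) (hc : c = fun a => l (Pi.single a 1)) :
    charFunDual ((gaussianPi X).map (fun v => B *ᵥ v)) l =
      Complex.exp (-((c ⬝ᵥ ((B * Bᵀ) *ᵥ c) : ℝ) : ℂ) / 2) := by
  have e := charFunDual_map (μ := gaussianPi X) (LinearMap.toContinuousLinearMap (mulVecLin B)) l
  have hl : ∀ w : κ → ℝ, l w = c ⬝ᵥ w := by
    intro w
    conv_lhs => rw [← Finset.univ_sum_single w]
    rw [map_sum, dotProduct]
    refine Finset.sum_congr rfl fun a _ => ?_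
    rw [show (Pi.single a (w a) : κ → ℝ) = w a • Pi.single a 1 by
      rw [← Pi.single_smul, smul_eq_mul, mul_one], map_smul, smul_eq_mul, mul_comm, hc]
  refine e.trans ?_
  rw [charFunDual_gaussianPi _ (c ᵥ* B)]
  · rw [← Matrix.mulVec_mulVec, Matrix.dotProduct_mulVec, Matrix.mulVec_transpose]
  · intro v
    rw [← Matrix.dotProduct_mulVec, ← hl]
    rfl

/-- The law of `L v`, `v` standard Gaussian, depends on `L Lᵀ` only. -/
theorem map_mulVec_gaussianPi_eq {Y : Type*} [Fintype Y] {L : Matrix κ X ℝ} {M : Matrix κ Y ℝ}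
    (h : L * Lᵀ = M * Mᵀ) :
    (gaussianPi X).map (fun v => L *ᵥ v) = (gaussianPi Y).map (fun v => M *ᵥ v) := by
  classical
  have := Measure.isProbabilityMeasure_map (μ := gaussianPi X) (measurable_mulVec L).aemeasurable
  have := Measure.isProbabilityMeasure_map (μ := gaussianPi Y) (measurable_mulVec M).aemeasurable
  refine Measure.ext_of_charFunDual (funext fun l => ?_)
  rw [charFunDual_map_mulVec_gaussianPi L l _ rfl, charFunDual_map_mulVec_gaussianPi M l _ rfl, h]

/-- A Gaussian vector `L v` whose covariance is `ε`-close to the identity has, up to a constant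
factor, law between those of the isotropic Gaussian vectors of variances `1 - ε` and `1 + ε`. -/
theorem gaussianPi_sandwich {L : Matrix κ X ℝ} {ε : ℝ} (hε : 0 ≤ ε) (hε1 : ε < 1)
    (hL : ∀ t : κ → ℝ, |t ⬝ᵥ ((L * Lᵀ) *ᵥ t) - t ⬝ᵥ t| ≤ ε * (t ⬝ᵥ t))
    {F : (κ → ℝ) → ℝ≥0∞} (hF : Measurable F) :
    ∫⁻ v, F (L *ᵥ v) ∂gaussianPi X ≤ ENNReal.ofReal (((1 + ε) / (1 - ε)) ^ Fintype.card κ) *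
        ∫⁻ z, F (√(1 + ε) • z) ∂gaussianPi κ ∧
    ∫⁻ z, F (√(1 - ε) • z) ∂gaussianPi κ ≤
      ENNReal.ofReal (((1 + ε) / (1 - ε)) ^ Fintype.card κ) *
        ∫⁻ v, F (L *ᵥ v) ∂gaussianPi X := by
  classical
  have hpsd : (L * Lᵀ).PosSemidef := by
    have := posSemidef_self_mul_conjTranspose L
    rwa [conjTranspose_eq_transpose_of_trivial] at this
  -- `L` is rectangular and has no inverse; the symmetric square root of `L * Lᵀ` is square and
  -- gives the same law.
  open scoped MatrixOrder in
  obtain ⟨M, hM⟩ : ∃ M : Matrix κ κ ℝ, L * Lᵀ = M * M ∧ Mᵀ = M := by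
    refine ⟨CFC.sqrt (L * Lᵀ), (CFC.sqrt_mul_sqrt_self _ hpsd.nonneg).symm, ?_⟩
    have := (CFC.sqrt_nonneg (L * Lᵀ)).isSelfAdjoint
    rwa [IsSelfAdjoint, star_eq_conjTranspose, conjTranspose_eq_transpose_of_trivial] at this
  obtain ⟨hLM, hMt⟩ := hM
  have hlaw : ∀ G : (κ → ℝ) → ℝ≥0∞, Measurable G →
      ∫⁻ v, G (L *ᵥ v) ∂gaussianPi X = ∫⁻ z, G (M *ᵥ z) ∂gaussianPi κ := by
    intro G hG
    rw [← lintegral_map hG (measurable_mulVec L), ← lintegral_map hG (measurable_mulVec M),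
      map_mulVec_gaussianPi_eq (L := L) (M := M) (by rw [hMt, hLM])]
  have hquad : ∀ t, (M *ᵥ t) ⬝ᵥ (M *ᵥ t) = t ⬝ᵥ ((L * Lᵀ) *ᵥ t) := by
    intro t
    rw [hLM, ← Matrix.mulVec_mulVec, Matrix.dotProduct_mulVec, ← Matrix.mulVec_transpose, hMt,
      dotProduct_comm]
  have hnn : ∀ t : κ → ℝ, 0 ≤ t ⬝ᵥ t := fun t =>
    Finset.sum_nonneg fun i _ => mul_self_nonneg (t i)
  have hup : ∀ t, (M *ᵥ t) ⬝ᵥ (M *ᵥ t) ≤ (1 + ε) * (t ⬝ᵥ t) := fun t => by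
    rw [hquad]; linarith [(abs_le.1 (hL t)).2]
  have hlo : ∀ t, (1 - ε) * (t ⬝ᵥ t) ≤ (M *ᵥ t) ⬝ᵥ (M *ᵥ t) := fun t => by
    rw [hquad]; linarith [(abs_le.1 (hL t)).1]
  have hdet : M.det ≠ 0 := by
    intro h0
    obtain ⟨t, ht, hMt0⟩ := exists_mulVec_eq_zero_iff.2 h0
    have h1 := hlo t
    rw [hMt0, dotProduct_zero] at h1
    have h2 : t ⬝ᵥ t ≤ 0 := by nlinarith [hnn t]
    exact ht (dotProduct_self_eq_zero.1 (le_antisymm h2 (hnn t)))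
  have hpos : 0 < 1 - ε := by linarith
  have hpos' : 0 < 1 + ε := by linarith
  have hsm : ∀ c : ℝ, ∀ z : κ → ℝ, (c • (1 : Matrix κ κ ℝ)) *ᵥ z = c • z := fun c z => by
    rw [Matrix.smul_mulVec, Matrix.one_mulVec]
  have hsd : ∀ c : ℝ, 0 < c → (√c • (1 : Matrix κ κ ℝ)).det = √c ^ Fintype.card κ := fun c _ => by
    rw [det_smul, det_one, mul_one]
  have hsd0 : ∀ c : ℝ, 0 < c → (√c • (1 : Matrix κ κ ℝ)).det ≠ 0 := fun c hc => by
    rw [hsd c hc]; exact pow_ne_zero _ (Real.sqrt_pos.2 hc).ne'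
  have hcmp_up := fun (G : (κ → ℝ) → ℝ≥0∞) (hG : Measurable G) =>
    lintegral_mulVec_gaussianPi_le hdet (hsd0 _ hpos') (fun z z' hz => by
      have h1 := hup z
      rw [hz, hsm, smul_dotProduct, dotProduct_smul, smul_eq_mul, smul_eq_mul, ← mul_assoc,
        Real.mul_self_sqrt hpos'.le] at h1
      exact le_of_mul_le_mul_left h1 hpos') hG
  have hcmp_lo := fun (G : (κ → ℝ) → ℝ≥0∞) (hG : Measurable G) =>
    lintegral_mulVec_gaussianPi_le (hsd0 _ hpos) hdet (fun z z' hz => by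
      have h1 := hlo z'
      rw [← hz, hsm, smul_dotProduct, dotProduct_smul, smul_eq_mul, smul_eq_mul, ← mul_assoc,
        Real.mul_self_sqrt hpos.le] at h1
      exact le_of_mul_le_mul_left h1 hpos) hG
  simp only [hsm, hsd _ hpos] at hcmp_lo
  simp only [hsm, hsd _ hpos'] at hcmp_up
  rw [hlaw F hF]
  set k := Fintype.card κ
  have ha : 0 < √(1 - ε) := Real.sqrt_pos.2 hpos
  have hb : 0 < √(1 + ε) := Real.sqrt_pos.2 hpos'
  rw [abs_of_pos (pow_pos ha k)] at hcmp_lo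
  rw [abs_of_pos (pow_pos hb k)] at hcmp_up
  have hd : 0 < |M.det| := abs_pos.2 hdet
  -- The comparison applied to the constant function 1 bounds the determinants themselves.
  have hd_up : |M.det| ≤ √(1 + ε) ^ k := by
    have := hcmp_up (fun _ => 1) measurable_const
    rwa [lintegral_const, measure_univ, one_mul, mul_one, mul_one,
      ENNReal.ofReal_le_ofReal_iff (pow_pos hb k).le] at this
  have hd_lo : √(1 - ε) ^ k ≤ |M.det| := by
    have := hcmp_lo (fun _ => 1) measurable_const
    rwa [lintegral_const, measure_univ, one_mul, mul_one, mul_one,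
      ENNReal.ofReal_le_ofReal_iff hd.le] at this
  -- The square root is given away, the base being at least 1.
  have hratio : √(1 + ε) ^ k / √(1 - ε) ^ k ≤ ((1 + ε) / (1 - ε)) ^ k := by
    rw [← div_pow, ← Real.sqrt_div hpos'.le]
    refine pow_le_pow_left₀ (Real.sqrt_nonneg _) ?_ k
    have h1 : 1 ≤ (1 + ε) / (1 - ε) := by rw [le_div_iff₀ hpos]; linarith
    rw [Real.sqrt_le_left (by positivity)]
    nlinarith
  have hdiv : ∀ (a b : ℝ) (I J : ℝ≥0∞), 0 < a → 0 ≤ b →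
      ENNReal.ofReal a * I ≤ ENNReal.ofReal b * J → I ≤ ENNReal.ofReal (b / a) * J := by
    intro a b I J ha hb h
    rw [ENNReal.ofReal_div_of_pos ha, ENNReal.div_eq_inv_mul, mul_assoc]
    rw [← ENNReal.div_eq_inv_mul,
      ENNReal.le_div_iff_mul_le (Or.inl (by simpa using ha)) (Or.inl ENNReal.ofReal_ne_top),
      mul_comm]
    exact h
  refine ⟨(hdiv _ _ _ _ hd (by positivity) (hcmp_up F hF)).trans ?_,
    (hdiv _ _ _ _ (by positivity) hd.le (hcmp_lo F hF)).trans ?_⟩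
  · gcongr
    refine le_trans ?_ hratio
    gcongr
  · gcongr
    refine le_trans ?_ hratio
    gcongr

end GaussianSandwich

/-! ### Signs and losses of independent Gaussians -/

section IIDGaussian

open MeasureTheory ProbabilityTheory

/-- The squared distance from `a |t|` to `1`, for the slope `a = 4 / 5`. -/
noncomputable def signLoss (t : ℝ) : ℝ≥0∞ := ENNReal.ofReal ((1 - 4 / 5 * |t|) ^ 2)

@[fun_prop]
theorem measurable_signLoss : Measurable signLoss := by unfold signLoss; fun_prop

theorem signLoss_neg (t : ℝ) : signLoss (-t) = signLoss t := by simp [signLoss]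

theorem measurable_decide_nonneg : Measurable fun t : ℝ => decide (0 ≤ t) :=
  measurable_to_bool (by
    have : (fun t : ℝ => decide (0 ≤ t)) ⁻¹' {true} = Set.Ici 0 := by ext; simp
    rw [this]; exact measurableSet_Ici)

@[fun_prop]
theorem measurable_sign_indicator (b : Bool) :
    Measurable fun t : ℝ => if decide (0 ≤ t) = b then (1 : ℝ≥0∞) else 0 :=
  Measurable.ite (measurable_decide_nonneg (measurableSet_singleton b)) measurable_const
    measurable_const

/-- The sign of a centred Gaussian is independent of its absolute value. The tie at 0, where `decide
(0 ≤ t)` is not odd, is a null set. -/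
theorem lintegral_sign_indicator_mul {e : ℝ → ℝ≥0∞} (he : Measurable e) (hev : ∀ t, e (-t) = e t)
    (b : Bool) :
    ∫⁻ t, (if decide (0 ≤ t) = b then 1 else 0) * e t ∂gaussianReal 0 1 =
      2⁻¹ * ∫⁻ t, e t ∂gaussianReal 0 1 := by
  have hsym : ∀ f : ℝ → ℝ≥0∞, Measurable f →
      ∫⁻ t, f (-t) ∂gaussianReal 0 1 = ∫⁻ t, f t ∂gaussianReal 0 1 := by
    intro f hf
    have := lintegral_map (μ := gaussianReal 0 1) hf measurable_neg
    rw [← this]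
    congr 1
    simpa using gaussianReal_map_neg (μ := 0) (v := 1)
  have hne : ∀ᵐ t ∂gaussianReal 0 1, t ≠ 0 := by
    have := nullSingletonClass_gaussianReal (μ := 0) (v := 1) one_ne_zero
    rw [ae_iff]
    simp
  have hm : Measurable fun t => (if decide (0 ≤ t) = b then 1 else 0) * e t :=
    (measurable_sign_indicator b).mul he
  have hflip : ∫⁻ t, (if decide (0 ≤ t) = b then 1 else 0) * e t ∂gaussianReal 0 1 =
      ∫⁻ t, (if decide (0 ≤ t) = !b then 1 else 0) * e t ∂gaussianReal 0 1 := by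
    rw [← hsym _ hm]
    refine lintegral_congr_ae ?_
    filter_upwards [hne] with t ht
    rw [hev]
    congr 1
    rcases lt_or_gt_of_ne ht with h | h
    · cases b <;> simp [h.le, not_le.2 h]
    · cases b <;> simp [h.le, not_le.2 h]
  have hsum : ∫⁻ t, e t ∂gaussianReal 0 1 =
      ∫⁻ t, (if decide (0 ≤ t) = b then 1 else 0) * e t ∂gaussianReal 0 1 +
      ∫⁻ t, (if decide (0 ≤ t) = !b then 1 else 0) * e t ∂gaussianReal 0 1 := by
    rw [← lintegral_add_left hm]
    refine lintegral_congr fun t => ?_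
    cases b <;> by_cases h : 0 ≤ t <;> simp [h]
  rw [hsum, ← hflip, ← two_mul, ← mul_assoc, ENNReal.inv_mul_cancel (by simp) (by simp), one_mul]

/-- The vectors whose coordinates in `P` have the signs prescribed by `s`. -/
def signCube {κ : Type*} (P : Finset κ) (s : κ → Bool) : Set (κ → ℝ) :=
  {z | ∀ a ∈ P, decide (0 ≤ z a) = s a}

theorem measurableSet_signCube {κ : Type*} (P : Finset κ) (s : κ → Bool) :
    MeasurableSet (signCube P s) := by
  simp only [signCube, Set.ofPred_forall]
  exact Finset.measurableSet_biInter P fun a _ =>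
    (measurable_decide_nonneg.comp (measurable_pi_apply a)) (measurableSet_singleton (s a))

theorem indicator_signCube_smul {κ : Type*} {P : Finset κ} {s : κ → Bool} {c : ℝ} (hc : 0 < c)
    (z : κ → ℝ) :
    (signCube P s).indicator (1 : (κ → ℝ) → ℝ≥0∞) (c • z) = (signCube P s).indicator 1 z := by
  have h : c • z ∈ signCube P s ↔ z ∈ signCube P s := by
    simp [signCube, mul_nonneg_iff_of_pos_left hc]
  by_cases hz : z ∈ signCube P s
  · rw [Set.indicator_of_mem hz, Set.indicator_of_mem (h.2 hz)]; rfl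
  · rw [Set.indicator_of_notMem hz, Set.indicator_of_notMem (mt h.1 hz)]

variable {κ : Type*} [Fintype κ] [DecidableEq κ]

theorem lintegral_subcube_mul_prod (P : Finset κ) (s : κ → Bool) {e : κ → ℝ → ℝ≥0∞}
    (he : ∀ a, Measurable (e a)) (hev : ∀ a t, e a (-t) = e a t) :
    ∫⁻ z, (signCube P s).indicator 1 z * ∏ a, e a (z a) ∂gaussianPi κ =
      2⁻¹ ^ P.card * ∏ a, ∫⁻ t, e a t ∂gaussianReal 0 1 := by
  have h1 : ∀ z : κ → ℝ, (signCube P s).indicator (1 : (κ → ℝ) → ℝ≥0∞) z *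
      ∏ a, e a (z a) =
      ∏ a, (if a ∈ P then (if decide (0 ≤ z a) = s a then 1 else 0) else 1) * e a (z a) := by
    intro z
    rw [Finset.prod_mul_distrib, Finset.prod_ite_mem, Finset.univ_inter, Finset.prod_boole]
    simp [Set.indicator_apply, signCube]
  simp_rw [h1]
  have h2 := lintegral_fintype_prod_eq_prod (μ := fun _ : κ => gaussianReal 0 1)
    (fun a t => (if a ∈ P then (if decide (0 ≤ t) = s a then 1 else 0) else 1) * e a t)
    (fun a => by
      by_cases ha : a ∈ P
      · simp only [ha, if_true]
        exact (measurable_sign_indicator _).mul (he a)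
      · simpa only [ha, if_false, one_mul] using he a)
  rw [gaussianPi, h2]
  have h3 : ∀ a, ∫⁻ t, (if a ∈ P then (if decide (0 ≤ t) = s a then 1 else 0) else 1) * e a t
      ∂gaussianReal 0 1 = (if a ∈ P then 2⁻¹ else 1) * ∫⁻ t, e a t ∂gaussianReal 0 1 := by
    intro a
    by_cases ha : a ∈ P
    · simp only [ha, if_true]
      exact lintegral_sign_indicator_mul (he a) (hev a) _
    · simp [ha]
  simp_rw [h3]
  rw [Finset.prod_mul_distrib, Finset.prod_ite_mem, Finset.univ_inter, Finset.prod_const]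

theorem lintegral_subcube_gaussianPi (P : Finset κ) (s : κ → Bool) {c : ℝ} (hc : 0 < c) :
    ∫⁻ z, (signCube P s).indicator 1 (c • z) ∂gaussianPi κ =
      2⁻¹ ^ P.card := by
  have := lintegral_subcube_mul_prod P s (e := fun _ _ => 1) (fun _ => measurable_const)
    (fun _ _ => rfl)
  simpa [indicator_signCube_smul hc] using this

theorem lintegral_subcube_mul_signLoss_mul_signLoss (P : Finset κ) (s : κ → Bool) (i j : κ) {c : ℝ}
    (hc : 0 < c) :
    ∫⁻ z, (signCube P s).indicator 1 (c • z) *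
        (signLoss ((c • z) i) * signLoss ((c • z) j)) ∂gaussianPi κ =
      2⁻¹ ^ P.card * if i = j then ∫⁻ t, signLoss (c * t) ^ 2 ∂gaussianReal 0 1 else
        (∫⁻ t, signLoss (c * t) ∂gaussianReal 0 1) ^ 2 := by
  have hev : ∀ t, signLoss (c * -t) = signLoss (c * t) := fun t => by rw [mul_neg, signLoss_neg]
  by_cases hij : i = j
  · subst hij
    have := lintegral_subcube_mul_prod P s
      (e := fun a t => if a = i then signLoss (c * t) ^ 2 else 1)
      (fun a => by by_cases h : a = i <;> simp only [h, if_true, if_false] <;> fun_prop)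
      (fun a t => by simp only [hev])
    rw [if_pos rfl]
    refine Eq.trans (lintegral_congr fun z => ?_) (this.trans ?_)
    · rw [Finset.prod_eq_single i (fun b _ hb => by simp [hb]) (by simp)]
      simp [indicator_signCube_smul hc, sq]
    · rw [Finset.prod_eq_single i (fun b _ hb => by simp [hb]) (by simp)]
      simp
  · have := lintegral_subcube_mul_prod P s
      (e := fun a t => if a = i ∨ a = j then signLoss (c * t) else 1)
      (fun a => by by_cases h : a = i ∨ a = j <;> simp only [h, if_true, if_false] <;> fun_prop)
      (fun a t => by simp only [hev])
    rw [if_neg hij]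
    refine Eq.trans (lintegral_congr fun z => ?_) (this.trans ?_)
    · rw [Fintype.prod_eq_mul i j hij (fun b hb => by simp [hb.1, hb.2])]
      simp [indicator_signCube_smul hc]
    · rw [Fintype.prod_eq_mul i j hij (fun b hb => by simp [hb.1, hb.2])]
      simp [sq]

theorem integrable_pow_gaussianReal (k : ℕ) : Integrable (fun t : ℝ => t ^ k) (gaussianReal 0 1) :=
  integrable_pow_of_mem_interior_integrableExpSet (X := fun t => t) (by
    rw [integrableExpSet_fun_id_gaussianReal]; simp) k

theorem integral_abs_gaussianReal : ∫ t, |t| ∂gaussianReal 0 1 = 2 / √(2 * Real.pi) := by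
  rw [integral_gaussianReal_eq_integral_smul one_ne_zero]
  let f : ℝ → ℝ := fun x => (√(2 * Real.pi))⁻¹ * (x ^ (1 : ℝ) * Real.exp (-(1 / 2) * x ^ (2 : ℝ)))
  have h1 : ∀ x : ℝ, gaussianPDFReal 0 1 x • |x| = f |x| := by
    intro x
    unfold f
    simp only [gaussianPDFReal, smul_eq_mul, Real.rpow_one, NNReal.coe_one, mul_one, sub_zero,
      Real.rpow_two, sq_abs]
    rw [show -x ^ 2 / 2 = -(1 / 2) * x ^ 2 by ring]
    ring
  simp_rw [h1]
  rw [integral_comp_abs]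
  unfold f
  rw [integral_const_mul,
    integral_rpow_mul_exp_neg_mul_rpow (by norm_num) (by norm_num) (by norm_num)]
  norm_num
  ring

theorem integral_abs_gaussianReal_ge : 0.79 ≤ ∫ t, |t| ∂gaussianReal 0 1 := by
  rw [integral_abs_gaussianReal, le_div_iff₀ (by positivity)]
  have h : √(2 * Real.pi) ≤ 2.52 := by
    rw [Real.sqrt_le_left (by norm_num)]
    linarith [Real.pi_lt_d2]
  linarith

/-- Expanding the square gives 1 - (8/5)c E|t| + (16/25)c², and E|t| = √(2/π) ≥ 0.79. The slope 4/5
is close to √(2/π), which minimises this at c = 1. -/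
theorem lintegral_signLoss_le {c : ℝ} (hc : 1 ≤ c) (hc' : c ^ 2 ≤ 1.01) :
    ∫⁻ t, signLoss (c * t) ∂gaussianReal 0 1 ≤ ENNReal.ofReal 0.3825 := by
  have i1 : Integrable (fun t : ℝ => |t|) (gaussianReal 0 1) := by
    simpa using (integrable_pow_gaussianReal 1).abs
  have i2 := integrable_pow_gaussianReal 2
  have e : ∀ t : ℝ, (1 - 4 / 5 * |c * t|) ^ 2 =
      (1 - (8 / 5 * c) * |t|) + (16 / 25 * c ^ 2) * t ^ 2 := by
    intro t
    rw [abs_mul, abs_of_pos (by linarith : 0 < c), ← sq_abs t]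
    ring
  have hsq : ∫ t, t ^ 2 ∂gaussianReal 0 1 = 1 := by
    have := variance_fun_id_gaussianReal (μ := 0) (v := 1)
    rwa [variance_of_integral_eq_zero (by fun_prop) (by simp)] at this
  unfold signLoss
  rw [← ofReal_integral_eq_lintegral_ofReal]
  · refine ENNReal.ofReal_le_ofReal ?_
    simp_rw [e]
    rw [integral_add (by fun_prop) (by fun_prop), integral_sub (by fun_prop) (by fun_prop),
      integral_const_mul, integral_const_mul, hsq]
    have := integral_abs_gaussianReal_ge
    simp only [integral_const, probReal_univ, smul_eq_mul]
    nlinarith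
  · simp_rw [e]; fun_prop
  · exact .of_forall fun t => sq_nonneg _

/-- Any bound uniform in `c` suffices: fourth moments enter only through the 2N diagonal terms among
4N² pairs. -/
theorem exists_lintegral_signLoss_sq_le : ∃ M : ℝ, 0 ≤ M ∧ ∀ c : ℝ, c ^ 2 ≤ 1.01 →
    ∫⁻ t, signLoss (c * t) ^ 2 ∂gaussianReal 0 1 ≤ ENNReal.ofReal M := by
  refine ⟨∫ t, (1 + t ^ 2) ^ 2 ∂gaussianReal 0 1, integral_nonneg fun t => sq_nonneg _,
    fun c hc => ?_⟩
  have i2 := integrable_pow_gaussianReal 2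
  have i4 := integrable_pow_gaussianReal 4
  rw [ofReal_integral_eq_lintegral_ofReal]
  · refine lintegral_mono fun t => ?_
    rw [signLoss, ← ENNReal.ofReal_pow (sq_nonneg _)]
    refine ENNReal.ofReal_le_ofReal (pow_le_pow_left₀ (sq_nonneg _) ?_ 2)
    have h1 : |c * t| ^ 2 ≤ 1.01 * t ^ 2 := by
      rw [sq_abs, mul_pow]; gcongr
    nlinarith [abs_nonneg (c * t), sq_nonneg t]
  · have : (fun t : ℝ => (1 + t ^ 2) ^ 2) = fun t => (1 + 2 * t ^ 2) + t ^ 4 := by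
      ext t; ring
    rw [this]; fun_prop
  · exact .of_forall fun t => sq_nonneg _

end IIDGaussian

/-! ### The Hadamard matrix and a deterministic bound on forrelation -/

section Hadamard

open Matrix

/-- The normalised `2^n × 2^n` Hadamard matrix. -/
noncomputable def hadamardMatrix (n : ℕ) : Matrix (Fin n → Bool) (Fin n → Bool) ℝ :=
  of fun x y => (√(2 ^ n))⁻¹ * (-1) ^ (∑ i, (x i).toNat * (y i).toNat)

variable {n : ℕ}

theorem hadamardMatrix_transpose : (hadamardMatrix n)ᵀ = hadamardMatrix n := by
  ext x y
  simp [hadamardMatrix, mul_comm]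

theorem abs_hadamardMatrix (x y : Fin n → Bool) : |hadamardMatrix n x y| = (√(2 ^ n))⁻¹ := by
  simp [hadamardMatrix, abs_mul, abs_pow]

/-- The sum over z factorises over the n coordinates; a coordinate where x and y differ contributes
1 - 1 = 0. -/
theorem hadamardMatrix_mul_self : hadamardMatrix n * hadamardMatrix n = 1 := by
  ext x y
  have h1 : ∀ z : Fin n → Bool, hadamardMatrix n x z * hadamardMatrix n z y =
      (2 ^ n)⁻¹ * ∏ i, (-1 : ℝ) ^ ((x i).toNat * (z i).toNat + (z i).toNat * (y i).toNat) := by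
    intro z
    simp only [hadamardMatrix, of_apply, pow_add, Finset.prod_mul_distrib,
      Finset.prod_pow_eq_pow_sum]
    have : (√(2 ^ n : ℝ))⁻¹ * (√(2 ^ n))⁻¹ = (2 ^ n)⁻¹ := by
      rw [← mul_inv, Real.mul_self_sqrt (by positivity)]
    rw [← this]
    ring
  rw [mul_apply, Finset.sum_congr rfl fun z _ => h1 z, ← Finset.mul_sum]
  have h2 := Finset.prod_univ_sum (fun _ : Fin n => (Finset.univ : Finset Bool))
    (fun i b => (-1 : ℝ) ^ ((x i).toNat * b.toNat + b.toNat * (y i).toNat))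
  rw [Fintype.piFinset_univ] at h2
  rw [← h2]
  have h3 : ∀ i, ∑ b : Bool, (-1 : ℝ) ^ ((x i).toNat * b.toNat + b.toNat * (y i).toNat) =
      if x i = y i then 2 else 0 := by
    intro i
    cases x i <;> cases y i <;> norm_num
  simp_rw [h3]
  by_cases hxy : x = y
  · subst hxy; simp
  · obtain ⟨i, hi⟩ := Function.ne_iff.1 hxy
    rw [Finset.prod_eq_zero (Finset.mem_univ i) (by simp [hi]), one_apply_ne hxy, mul_zero]

theorem hadamardMatrix_mulVec_mulVec (u : (Fin n → Bool) → ℝ) :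
    hadamardMatrix n *ᵥ (hadamardMatrix n *ᵥ u) = u := by
  rw [Matrix.mulVec_mulVec, hadamardMatrix_mul_self, Matrix.one_mulVec]

theorem dotProduct_hadamardMatrix_mulVec (u w : (Fin n → Bool) → ℝ) :
    (hadamardMatrix n *ᵥ u) ⬝ᵥ w = u ⬝ᵥ (hadamardMatrix n *ᵥ w) := by
  rw [Matrix.dotProduct_mulVec, ← Matrix.mulVec_transpose, hadamardMatrix_transpose]

theorem hadamardMatrix_mulVec_dotProduct_self (u : (Fin n → Bool) → ℝ) :
    (hadamardMatrix n *ᵥ u) ⬝ᵥ (hadamardMatrix n *ᵥ u) = u ⬝ᵥ u := by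
  rw [dotProduct_hadamardMatrix_mulVec, hadamardMatrix_mulVec_mulVec]

/-- The bit `b` as a real number in `{-1, 1}`. -/
def realSign (b : Bool) : ℝ := if b then 1 else -1

theorem realSign_mul_self (b : Bool) : realSign b * realSign b = 1 := by
  cases b <;> simp [realSign]

theorem bitSign_cast (b : Bool) : ((bitSign b : ℤ) : ℝ) = realSign b := by
  cases b <;> simp [realSign, bitSign]

/-- The forrelation of the two functions whose truth tables are listed in `z`. -/
noncomputable def bitForrelation (z : ForIndex n → Bool) : ℝ :=
  forrelation n (fun x => bitSign (z (.inl x))) (fun y => bitSign (z (.inr y)))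

theorem bitForrelation_eq (z : ForIndex n → Bool) :
    bitForrelation z = (2 ^ n)⁻¹ * ((fun x => realSign (z (.inl x))) ⬝ᵥ
      (hadamardMatrix n *ᵥ fun y => realSign (z (.inr y)))) := by
  have h : (1 : ℝ) / 2 ^ (3 * (n : ℝ) / 2) = (2 ^ n)⁻¹ * (√(2 ^ n))⁻¹ := by
    rw [one_div, ← mul_inv, Real.sqrt_eq_rpow, ← Real.rpow_natCast, ← Real.rpow_mul (by norm_num),
      ← Real.rpow_add (by norm_num)]
    congr 2
    ring
  simp only [bitForrelation, forrelation, bitSign_cast, h, dotProduct, mulVec, hadamardMatrix,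
    of_apply, Finset.mul_sum]
  refine Finset.sum_congr rfl fun x _ => Finset.sum_congr rfl fun y _ => ?_
  ring

theorem For_eq_some_true {z : ForIndex n → Bool} (h : 0.07 ≤ bitForrelation z) :
    For n z = some true := if_pos h

theorem For_eq_some_false {z : ForIndex n → Bool} (h : |bitForrelation z| ≤ 0.01) :
    For n z = some false := by
  have h' : ¬ 0.07 ≤ bitForrelation z := fun h' => by
    have := (abs_le.1 h).2
    norm_num at h' this
    linarith
  exact (if_neg h').trans (if_pos h)

/-- The rows are the linear forms on `ℝ^(2^n)` given by the coordinates and by the coordinates of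
the Hadamard transform. -/
noncomputable def forForms (n : ℕ) : Matrix (ForIndex n) (Fin n → Bool) ℝ :=
  fromRows 1 (hadamardMatrix n)

/-- The Gram matrix has identity diagonal blocks, because H is orthogonal, and H as off-diagonal
blocks. -/
theorem abs_forForms_gram_sub_one (a b : ForIndex n) :
    |(forForms n * (forForms n)ᵀ) a b - (1 : Matrix _ _ ℝ) a b| ≤ (√(2 ^ n))⁻¹ := by
  rw [forForms, transpose_fromRows, fromRows_mul_fromCols, hadamardMatrix_transpose,
    hadamardMatrix_mul_self, ← fromBlocks_one]
  have h0 : (0 : ℝ) ≤ (√(2 ^ n))⁻¹ := by positivity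
  rcases a with a | a <;> rcases b with b | b <;> simp [abs_hadamardMatrix, h0]

theorem abs_quadratic_sub_le {κ : Type*} [Fintype κ] [DecidableEq κ] {G : Matrix κ κ ℝ} {δ : ℝ}
    (h : ∀ a b, |G a b - (1 : Matrix κ κ ℝ) a b| ≤ δ) (t : κ → ℝ) :
    |t ⬝ᵥ (G *ᵥ t) - t ⬝ᵥ t| ≤ δ * Fintype.card κ * (t ⬝ᵥ t) := by
  have h1 : t ⬝ᵥ (G *ᵥ t) - t ⬝ᵥ t = ∑ a, ∑ b, t a * (G a b - (1 : Matrix κ κ ℝ) a b) * t b := by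
    have : t ⬝ᵥ (G *ᵥ t) - t ⬝ᵥ t = t ⬝ᵥ ((G - 1) *ᵥ t) := by
      rw [Matrix.sub_mulVec, Matrix.one_mulVec, dotProduct_sub]
    rw [this]
    simp [dotProduct, mulVec, Finset.mul_sum, mul_assoc]
  rw [h1]
  calc _ ≤ ∑ a, ∑ b, |t a| * δ * |t b| := by
        refine (Finset.abs_sum_le_sum_abs _ _).trans (Finset.sum_le_sum fun a _ => ?_)
        refine (Finset.abs_sum_le_sum_abs _ _).trans (Finset.sum_le_sum fun b _ => ?_)
        rw [abs_mul, abs_mul]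
        gcongr
        exact h a b
    _ = δ * (∑ a, |t a|) ^ 2 := by
        rw [sq, Finset.sum_mul_sum, Finset.mul_sum]
        refine Finset.sum_congr rfl fun a _ => ?_
        rw [Finset.mul_sum]
        exact Finset.sum_congr rfl fun b _ => by ring
    _ ≤ δ * (Fintype.card κ * (t ⬝ᵥ t)) := by
        rcases isEmpty_or_nonempty κ with hκ | ⟨⟨a⟩⟩
        · simp
        · have hδ : 0 ≤ δ := (abs_nonneg _).trans (h a a)
          gcongr
          have := sq_sum_le_card_mul_sum_sq (s := (Finset.univ : Finset κ)) (f := fun a => |t a|)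
          simpa [dotProduct, sq] using this
    _ = _ := by ring

theorem sum_forIndex (F : ForIndex n → ℝ) :
    ∑ a, F a = ∑ x, F (.inl x) + ∑ y, F (.inr y) := Fintype.sum_sum_type F

/-- Rounding `v` and its Hadamard transform to signs gives a small forrelation only if the
absolute values of their coordinates are far from constant. -/
theorem le_sum_signLoss {v : (Fin n → Bool) → ℝ}
    (h : bitForrelation (fun a => decide (0 ≤ (forForms n *ᵥ v) a)) < 0.07) :
    ENNReal.ofReal (0.93 * 2 ^ n) ≤ ∑ a, signLoss ((forForms n *ᵥ v) a) := by
  unfold signLoss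
  rw [← ENNReal.ofReal_sum_of_nonneg fun _ _ => sq_nonneg _]
  refine ENNReal.ofReal_le_ofReal ?_
  set H := hadamardMatrix n with hH
  set w := H *ᵥ v with hw
  have hl : ∀ x, (forForms n *ᵥ v) (.inl x) = v x := fun x => by
    simp [forForms, fromRows_mulVec]
  have hr : ∀ y, (forForms n *ᵥ v) (.inr y) = w y := fun y => by
    simp [forForms, fromRows_mulVec, hw, hH]
  rw [bitForrelation_eq] at h
  rw [sum_forIndex]
  simp only [hl, hr] at h ⊢
  set f : (Fin n → Bool) → ℝ := fun x => realSign (decide (0 ≤ v x)) with hf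
  set g : (Fin n → Bool) → ℝ := fun y => realSign (decide (0 ≤ w y)) with hg
  have hcard : ∀ z : (Fin n → Bool) → Bool,
      (fun x => realSign (z x)) ⬝ᵥ (fun x => realSign (z x)) = (2 : ℝ) ^ n := fun z => by
    simp [dotProduct, realSign_mul_self]
  have hff : f ⬝ᵥ f = 2 ^ n := hcard _
  have hgg : g ⬝ᵥ g = 2 ^ n := hcard _
  have hloss : ∀ u : (Fin n → Bool) → ℝ, ∑ x, (1 - 4 / 5 * |u x|) ^ 2 =
      ((fun x => realSign (decide (0 ≤ u x))) - (4 / 5 : ℝ) • u) ⬝ᵥ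
        ((fun x => realSign (decide (0 ≤ u x))) - (4 / 5 : ℝ) • u) := by
    intro u
    refine Finset.sum_congr rfl fun x _ => ?_
    simp only [Pi.sub_apply, Pi.smul_apply, smul_eq_mul, realSign]
    by_cases hx : 0 ≤ u x
    · simp [hx, abs_of_nonneg hx, sq]
    · simp [hx, abs_of_neg (not_le.1 hx)]; ring
  rw [hloss v, hloss w]
  set p := f - (4 / 5 : ℝ) • v with hp
  set q := g - (4 / 5 : ℝ) • w with hq
  -- The Gaussian parts cancel because Hw = v. The squared norm of the left side is 2N(1 - Φ), that
  -- of the right at most twice the total loss.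
  have hpq : f - H *ᵥ g = p - H *ᵥ q := by
    rw [hp, hq, Matrix.mulVec_sub, Matrix.mulVec_smul, hw, hadamardMatrix_mulVec_mulVec]
    abel
  have hexp : (f - H *ᵥ g) ⬝ᵥ (f - H *ᵥ g) = 2 * 2 ^ n - 2 * (f ⬝ᵥ (H *ᵥ g)) := by
    rw [sub_dotProduct, dotProduct_sub, dotProduct_sub, hadamardMatrix_mulVec_dotProduct_self,
      hff, hgg, dotProduct_comm (H *ᵥ g) f]
    ring
  have hpar : (p - H *ᵥ q) ⬝ᵥ (p - H *ᵥ q) ≤ 2 * (p ⬝ᵥ p + q ⬝ᵥ q) := by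
    rw [← hadamardMatrix_mulVec_dotProduct_self q]
    simp only [dotProduct, ← Finset.sum_add_distrib, Finset.mul_sum, Pi.sub_apply]
    refine Finset.sum_le_sum fun x _ => ?_
    nlinarith [sq_nonneg (p x + (H *ᵥ q) x)]
  rw [hpq] at hexp
  have hN : (0 : ℝ) < 2 ^ n := by positivity
  rw [inv_mul_lt_iff₀ hN] at h
  linarith

end Hadamard

/-! ### Uniform inputs have small forrelation on every small-codimension subcube -/

section UniformInput

open Matrix

theorem sum_realSign_mul_realSign {Y : Type*} [Fintype Y] [DecidableEq Y] (y y' : Y) :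
    ∑ g : Y → Bool, realSign (g y) * realSign (g y') =
      if y = y' then 2 ^ Fintype.card Y else 0 := by
  split_ifs with h
  · subst h
    simp [realSign_mul_self]
  · have hinv : Function.Involutive fun g : Y → Bool => Function.update g y (!g y) := by
      intro g; ext z
      by_cases hz : z = y
      · subst hz; simp
      · simp [hz]
    have e := Equiv.sum_comp (hinv.toPerm _) fun g : Y → Bool => realSign (g y) * realSign (g y')
    have hterm : ∀ g : Y → Bool, realSign ((hinv.toPerm _) g y) * realSign ((hinv.toPerm _) g y') =
        -(realSign (g y) * realSign (g y')) := by
      intro g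
      simp only [Function.Involutive.coe_toPerm, Function.update_self,
        Function.update_of_ne (Ne.symm h)]
      cases g y <;> cases g y' <;> simp [realSign]
    rw [Finset.sum_congr rfl fun g _ => hterm g, Finset.sum_neg_distrib] at e
    linarith

theorem sum_dotProduct_realSign_sq {Y : Type*} [Fintype Y] [DecidableEq Y] (u : Y → ℝ) :
    ∑ g : Y → Bool, (u ⬝ᵥ fun y => realSign (g y)) ^ 2 = 2 ^ Fintype.card Y * (u ⬝ᵥ u) := by
  have h : ∀ g : Y → Bool, (u ⬝ᵥ fun y => realSign (g y)) ^ 2 =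
      ∑ y, ∑ y', u y * u y' * (realSign (g y) * realSign (g y')) := by
    intro g
    rw [sq, dotProduct, Finset.sum_mul_sum]
    refine Finset.sum_congr rfl fun y _ => Finset.sum_congr rfl fun y' _ => by ring
  simp_rw [h]
  rw [Finset.sum_comm]
  simp_rw [fun y => Finset.sum_comm (s := (Finset.univ : Finset (Y → Bool)))
    (t := (Finset.univ : Finset Y))
    (f := fun g y' => u y * u y' * (realSign (g y) * realSign (g y'))),
    ← Finset.mul_sum, sum_realSign_mul_realSign]
  simp [dotProduct, Finset.mul_sum, mul_comm]

variable {n : ℕ}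

/-- For fixed f, NΦ is a Rademacher sum in g with coefficient vector Hf, of squared norm N. -/
theorem sum_bitForrelation_sq :
    ∑ z : ForIndex n → Bool, bitForrelation z ^ 2 =
      2 ^ Fintype.card (ForIndex n) * (2 ^ n)⁻¹ := by
  rw [← (Equiv.sumArrowEquivProdArrow _ _ _).symm.sum_comp, Fintype.sum_prod_type]
  have h : ∀ (f g : (Fin n → Bool) → Bool),
      bitForrelation ((Equiv.sumArrowEquivProdArrow _ _ _).symm (f, g)) ^ 2 =
      ((2 ^ n)⁻¹) ^ 2 * ((hadamardMatrix n *ᵥ fun x => realSign (f x)) ⬝ᵥ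
        fun y => realSign (g y)) ^ 2 := by
    intro f g
    rw [bitForrelation_eq, mul_pow, dotProduct_hadamardMatrix_mulVec]
    rfl
  simp_rw [h, ← Finset.mul_sum, sum_dotProduct_realSign_sq, hadamardMatrix_mulVec_dotProduct_self]
  simp only [dotProduct, realSign_mul_self, Finset.sum_const, Finset.card_univ, Fintype.card_fun,
    Fintype.card_bool, Fintype.card_fin, nsmul_eq_mul, Nat.cast_pow, Nat.cast_ofNat, mul_one,
    Fintype.card_sum]
  rw [pow_add]
  field_simp

theorem card_bitForrelation_gt {δ : ℝ} (hδ : 0 < δ) :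
    ((Finset.univ.filter fun z : ForIndex n → Bool => δ < |bitForrelation z|).card : ℝ) ≤
      2 ^ Fintype.card (ForIndex n) * ((2 ^ n)⁻¹ / δ ^ 2) := by
  rw [← mul_div_assoc, le_div_iff₀ (by positivity), ← sum_bitForrelation_sq, ← nsmul_eq_mul,
    ← Finset.sum_const]
  refine (Finset.sum_le_sum fun z hz => ?_).trans
    (Finset.sum_le_sum_of_subset_of_nonneg (Finset.subset_univ _) fun _ _ _ => sq_nonneg _)
  rw [← sq_abs (bitForrelation z)]
  exact pow_le_pow_left₀ hδ.le (Finset.mem_filter.1 hz).2.le 2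

theorem abs_dotProduct_le {Y : Type*} [Fintype Y] (u w : Y → ℝ) {a b : ℝ} (hu : u ⬝ᵥ u ≤ a)
    (hw : w ⬝ᵥ w ≤ b) : |u ⬝ᵥ w| ≤ √(a * b) := by
  refine Real.abs_le_sqrt ?_
  have h := Finset.sum_mul_sq_le_sq_mul_sq Finset.univ u w
  have h0 : ∀ v : Y → ℝ, 0 ≤ v ⬝ᵥ v := fun v => Finset.sum_nonneg fun i _ => mul_self_nonneg (v i)
  have h1 := mul_le_mul hu hw (h0 w) ((h0 u).trans hu)
  simp only [dotProduct, sq] at h h1 ⊢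
  linarith

theorem dotProduct_realSign_sub_le {Y : Type*} [Fintype Y] {z z' : Y → Bool} {S : Finset Y}
    (h : ∀ y ∉ S, z y = z' y) :
    ((fun y => realSign (z y)) - fun y => realSign (z' y)) ⬝ᵥ
      ((fun y => realSign (z y)) - fun y => realSign (z' y)) ≤ 4 * S.card := by
  classical
  have h1 : ∀ y, (realSign (z y) - realSign (z' y)) * (realSign (z y) - realSign (z' y)) ≤
      if y ∈ S then 4 else 0 := by
    intro y
    split_ifs with hy
    · cases z y <;> cases z' y <;> norm_num [realSign]
    · simp [h y hy]
  refine (Finset.sum_le_sum fun y _ => h1 y).trans ?_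
  simp [mul_comm]

/-- Changing few bits changes the forrelation by little. -/
theorem abs_bitForrelation_sub_le {z z' : ForIndex n → Bool} {K : Finset (ForIndex n)}
    (h : ∀ i ∉ K, z i = z' i) :
    |bitForrelation z - bitForrelation z'| ≤ (2 ^ n)⁻¹ * (2 * √(4 * K.card * 2 ^ n)) := by
  have hcard : ∀ z : (Fin n → Bool) → Bool,
      (fun x => realSign (z x)) ⬝ᵥ (fun x => realSign (z x)) ≤ (2 : ℝ) ^ n := fun z => by
    simp [dotProduct, realSign_mul_self]
  have hsub : ∀ e : (Fin n → Bool) → ForIndex n, Function.Injective e →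
      ((fun y => realSign (z (e y))) - fun y => realSign (z' (e y))) ⬝ᵥ
      ((fun y => realSign (z (e y))) - fun y => realSign (z' (e y))) ≤ 4 * (K.card : ℝ) := by
    intro e he
    refine (dotProduct_realSign_sub_le (S := K.preimage e he.injOn) fun y hy => ?_).trans ?_
    · exact h _ fun hm => hy (Finset.mem_preimage.2 hm)
    · have : (K.preimage e he.injOn).card ≤ K.card :=
        Finset.card_le_card_of_injOn e (fun y hy => Finset.mem_preimage.1 hy) he.injOn
      gcongr
  rw [bitForrelation_eq, bitForrelation_eq, ← mul_sub, abs_mul, abs_of_pos (by positivity)]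
  gcongr
  set f := fun x => realSign (z (.inl x))
  set g := fun x => realSign (z (.inr x))
  set f' := fun x => realSign (z' (.inl x))
  set g' := fun x => realSign (z' (.inr x))
  -- Changing f and g one at a time leaves two products for Cauchy–Schwarz: a difference of squared
  -- norm at most 4|K| against a vector of squared norm at most 2^n.
  have e : f ⬝ᵥ (hadamardMatrix n *ᵥ g) - f' ⬝ᵥ (hadamardMatrix n *ᵥ g') =
      (f - f') ⬝ᵥ (hadamardMatrix n *ᵥ g) + (g - g') ⬝ᵥ (hadamardMatrix n *ᵥ f') := by
    rw [dotProduct_comm (g - g'), dotProduct_hadamardMatrix_mulVec f', Matrix.mulVec_sub,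
      sub_dotProduct, dotProduct_sub]
    ring
  rw [e, two_mul]
  refine (abs_add_le _ _).trans (add_le_add ?_ ?_)
  · exact abs_dotProduct_le _ _ (hsub _ Sum.inl_injective)
      ((hadamardMatrix_mulVec_dotProduct_self g).le.trans (hcard _))
  · exact abs_dotProduct_le _ _ (hsub _ Sum.inr_injective)
      ((hadamardMatrix_mulVec_dotProduct_self f').le.trans (hcard _))

variable {ι : Type} [Fintype ι] [DecidableEq ι]

theorem card_subcube_mul (K : Finset ι) (s : ι → Bool) :
    (Finset.univ.filter fun z : ι → Bool => ∀ i ∈ K, z i = s i).card * 2 ^ K.card =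
      2 ^ Fintype.card ι := by
  have h1 : (Finset.univ.filter fun z : ι → Bool => ∀ i ∈ K, z i = s i) =
      Fintype.piFinset fun i => if i ∈ K then {s i} else Finset.univ := by
    ext z
    simp only [Finset.mem_filter, Finset.mem_univ, true_and, Fintype.mem_piFinset]
    refine forall_congr' fun i => ?_
    by_cases hi : i ∈ K <;> simp [hi]
  have h2 : 2 ^ K.card = ∏ i, if i ∈ K then 2 else 1 := by simp
  rw [h1, Fintype.card_piFinset, h2, ← Finset.prod_mul_distrib]
  refine (Finset.prod_congr rfl fun i _ => ?_).trans (Finset.prod_const 2)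
  by_cases hi : i ∈ K <;> simp [hi]

/-- Overwriting the bits in `K` in all 2^|K| ways is injective on the subcube, where those bits were
fixed. A conditional count is thereby bounded by an unconditional one. -/
theorem card_subcube_filter_mul_le (K : Finset ι) (s : ι → Bool) {p p' : (ι → Bool) → Prop}
    [DecidablePred p] [DecidablePred p']
    (h : ∀ z z' : ι → Bool, (∀ i ∉ K, z i = z' i) → p z → p' z') :
    (Finset.univ.filter fun z : ι → Bool => (∀ i ∈ K, z i = s i) ∧ p z).card * 2 ^ K.card ≤
      (Finset.univ.filter p').card := by
  have hc : 2 ^ K.card = (Finset.univ : Finset (K → Bool)).card := by simp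
  rw [hc, ← Finset.card_product]
  refine Finset.card_le_card_of_injOn
    (fun a : (ι → Bool) × (K → Bool) => fun i => if hi : i ∈ K then a.2 ⟨i, hi⟩ else a.1 i) ?_ ?_
  · rintro ⟨c, t⟩ hct
    simp only [Finset.coe_product, Finset.coe_filter, Finset.coe_univ, Set.mem_prod,
      Set.mem_ofPred_eq, Finset.mem_univ, true_and] at hct
    simp only [Finset.coe_filter, Finset.mem_univ, true_and, Set.mem_ofPred_eq]
    exact h c _ (fun i hi => by simp [hi]) hct.1.2
  · rintro ⟨c, t⟩ hct ⟨c', t'⟩ hct' heq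
    simp only [Finset.coe_product, Finset.coe_filter, Finset.coe_univ, Set.mem_prod,
      Set.mem_ofPred_eq, Finset.mem_univ, true_and] at hct hct'
    refine Prod.ext (funext fun i => ?_) (funext fun i => ?_)
    · by_cases hi : i ∈ K
      · exact (hct.1.1 i hi).trans (hct'.1.1 i hi).symm
      · simpa [hi] using congrFun heq i
    · simpa using congrFun heq i

open Classical in
/-- The uniform distribution restricted to the inputs of small forrelation. -/
noncomputable def uniformWeight (n : ℕ) (z : ForIndex n → Bool) : ℝ≥0∞ :=
  if |bitForrelation z| ≤ 0.01 then 2⁻¹ ^ Fintype.card (ForIndex n) else 0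

theorem sum_uniformWeight_le (K : Finset (ForIndex n)) (s : ForIndex n → Bool) :
    ∑ z with (∀ i ∈ K, z i = s i), uniformWeight n z ≤ 2⁻¹ ^ K.card := by
  calc _ ≤ ∑ z : ForIndex n → Bool with (∀ i ∈ K, z i = s i),
          (2⁻¹ : ℝ≥0∞) ^ Fintype.card (ForIndex n) := by
        refine Finset.sum_le_sum fun z _ => ?_
        unfold uniformWeight
        split_ifs <;> simp
    _ = _ := by
        have h := congrArg (Nat.cast (R := ℝ≥0∞)) (card_subcube_mul K s)
        push_cast at h
        rw [Finset.sum_const, nsmul_eq_mul, ← ENNReal.inv_pow, ← ENNReal.inv_pow, ← div_eq_mul_inv,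
          eq_comm, ENNReal.eq_div_iff (by simp) (by finiteness), ← h,
          ENNReal.mul_inv_cancel_right (by simp) (by finiteness)]

theorem le_sum_uniformWeight {q : ℕ} (hN : 4000000 ≤ (2 : ℝ) ^ n)
    (hq : 2 * √(4 * q * 2 ^ n) ≤ 0.005 * 2 ^ n) {K : Finset (ForIndex n)} (hK : K.card ≤ q)
    (s : ForIndex n → Bool) :
    ENNReal.ofReal 0.99 * 2⁻¹ ^ K.card ≤ ∑ z with (∀ i ∈ K, z i = s i), uniformWeight n z := by
  classical
  -- Overwriting `K` moves Φ by at most 0.005, so the threshold drops from 0.01 to 0.005.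
  have hbad := card_subcube_filter_mul_le K s
    (p := fun z => 0.01 < |bitForrelation z|) (p' := fun z => 0.005 < |bitForrelation z|)
    (fun z z' hzz' hz => by
      have h1 := abs_bitForrelation_sub_le hzz'
      have h2 : (2 ^ n : ℝ)⁻¹ * (2 * √(4 * K.card * 2 ^ n)) ≤ 0.005 := by
        rw [inv_mul_le_iff₀ (by positivity), mul_comm (2 ^ n : ℝ)]
        refine le_trans ?_ hq
        gcongr
      have h3 := abs_sub_abs_le_abs_sub (bitForrelation z) (bitForrelation z')
      have h4 := h3.trans (h1.trans h2)
      change 0.005 < |bitForrelation z'|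
      change 0.01 < |bitForrelation z| at hz
      norm_num at hz h4 ⊢
      linarith)
  have hbad' := card_bitForrelation_gt (n := n) (δ := 0.005) (by norm_num)
  have hcube := card_subcube_mul K s
  have hsplit := Finset.card_filter_add_card_filter_not
    (s := Finset.univ.filter fun z : ForIndex n → Bool => ∀ i ∈ K, z i = s i)
    (fun z => |bitForrelation z| ≤ 0.01)
  simp only [Finset.filter_filter, not_le] at hsplit
  set T := Fintype.card (ForIndex n)
  set cb := (Finset.univ.filter fun z : ForIndex n → Bool =>
    (∀ i ∈ K, z i = s i) ∧ 0.01 < |bitForrelation z|).card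
  set cg := (Finset.univ.filter fun z : ForIndex n → Bool =>
    (∀ i ∈ K, z i = s i) ∧ |bitForrelation z| ≤ 0.01).card with hcg
  have hsum : ∑ z with (∀ i ∈ K, z i = s i), uniformWeight n z = cg * 2⁻¹ ^ T := by
    unfold uniformWeight
    rw [← Finset.sum_filter, Finset.filter_filter, Finset.sum_const, nsmul_eq_mul]
  have hreal : 0.99 * (2 : ℝ) ^ T ≤ cg * 2 ^ K.card := by
    have e1 : ((cg : ℝ) + cb) * 2 ^ K.card = 2 ^ T := by
      rw [← hsplit] at hcube
      exact_mod_cast hcube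
    have e2 : (cb : ℝ) * 2 ^ K.card ≤ 2 ^ T * ((2 ^ n)⁻¹ / 0.005 ^ 2) := by
      refine le_trans ?_ hbad'
      exact_mod_cast hbad
    -- Chebyshev's inequality; 4000000 is 1 / (0.005² · 0.01).
    have e3 : (2 ^ n : ℝ)⁻¹ / 0.005 ^ 2 ≤ 0.01 := by
      rw [div_le_iff₀ (by norm_num), inv_le_comm₀ (by positivity) (by norm_num)]
      norm_num
      linarith
    have e4 : (0 : ℝ) < 2 ^ T := by positivity
    nlinarith
  have hE : ENNReal.ofReal 0.99 * 2 ^ T ≤ cg * 2 ^ K.card := by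
    have := ENNReal.ofReal_le_ofReal hreal
    rwa [ENNReal.ofReal_mul (by norm_num), ENNReal.ofReal_mul (by positivity),
      ENNReal.ofReal_pow (by norm_num), ENNReal.ofReal_pow (by norm_num), ENNReal.ofReal_natCast,
      ENNReal.ofReal_ofNat] at this
  rw [hsum, ← ENNReal.inv_pow, ← ENNReal.inv_pow, ← div_eq_mul_inv, ← div_eq_mul_inv,
    ENNReal.div_le_iff (by simp) (by finiteness), div_eq_mul_inv, mul_right_comm, ← div_eq_mul_inv,
    ENNReal.le_div_iff_mul_le (Or.inl (by simp)) (Or.inl (by finiteness))]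
  exact hE

end UniformInput

/-! ### The rounded Gaussian on subcubes -/

section GaussianRounding

open MeasureTheory Matrix

variable {n : ℕ}

/-- The signs of a vector and of its Hadamard transform. -/
noncomputable def roundBits (v : (Fin n → Bool) → ℝ) : ForIndex n → Bool :=
  fun a => decide (0 ≤ (forForms n *ᵥ v) a)

theorem measurable_forForms (a : ForIndex n) :
    Measurable fun v : (Fin n → Bool) → ℝ => (forForms n *ᵥ v) a :=
  (measurable_pi_apply a).comp (measurable_mulVec _)

theorem measurable_roundBits : Measurable (roundBits (n := n)) :=
  measurable_pi_iff.2 fun a => measurable_decide_nonneg.comp (measurable_forForms a)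

theorem measurableSet_roundBits (p : (ForIndex n → Bool) → Prop) :
    MeasurableSet {v : (Fin n → Bool) → ℝ | p (roundBits v)} :=
  measurable_roundBits (Set.toFinite {z | p z}).measurableSet

/-- Few of the linear forms are jointly almost isotropic. -/
theorem forForms_sandwich {Q : ℕ} (h1 : Q / √(2 ^ n) < 1) {K : Finset (ForIndex n)}
    (hK : K.card ≤ Q) {F : (K → ℝ) → ℝ≥0∞} (hF : Measurable F) :
    ∫⁻ v, F (fun a => (forForms n *ᵥ v) a) ∂gaussianPi (Fin n → Bool) ≤
      ENNReal.ofReal (((1 + Q / √(2 ^ n)) / (1 - Q / √(2 ^ n))) ^ Q) *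
        ∫⁻ z, F (√(1 + Q / √(2 ^ n)) • z) ∂gaussianPi K ∧
    ∫⁻ z, F (√(1 - Q / √(2 ^ n)) • z) ∂gaussianPi K ≤
      ENNReal.ofReal (((1 + Q / √(2 ^ n)) / (1 - Q / √(2 ^ n))) ^ Q) *
        ∫⁻ v, F (fun a => (forForms n *ᵥ v) a) ∂gaussianPi (Fin n → Bool) := by
  set ε : ℝ := Q / √(2 ^ n) with hε
  have h0 : 0 ≤ ε := by positivity
  set L : Matrix K (Fin n → Bool) ℝ := (forForms n).submatrix (fun a : K => (a : ForIndex n)) id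
  have hL : ∀ t : K → ℝ, |t ⬝ᵥ ((L * Lᵀ) *ᵥ t) - t ⬝ᵥ t| ≤ ε * (t ⬝ᵥ t) := by
    intro t
    have hG : ∀ a b, |(L * Lᵀ) a b - (1 : Matrix K K ℝ) a b| ≤ (√(2 ^ n))⁻¹ := by
      intro a b
      have := abs_forForms_gram_sub_one (n := n) a b
      simp only [Matrix.one_apply, Subtype.ext_iff] at this ⊢
      exact this
    refine (abs_quadratic_sub_le hG t).trans ?_
    have hn : 0 ≤ t ⬝ᵥ t := Finset.sum_nonneg fun i _ => mul_self_nonneg (t i)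
    rw [hε, div_eq_inv_mul]
    gcongr
    simpa using hK
  have hR : ((1 + ε) / (1 - ε)) ^ Fintype.card K ≤ ((1 + ε) / (1 - ε)) ^ Q := by
    refine pow_le_pow_right₀ ?_ (by simpa using hK)
    rw [le_div_iff₀ (by linarith)]
    linarith
  obtain ⟨hu, hl⟩ := gaussianPi_sandwich h0 h1 hL hF
  exact ⟨hu.trans (mul_le_mul_left (ENNReal.ofReal_le_ofReal hR) _),
    hl.trans (mul_le_mul_left (ENNReal.ofReal_le_ofReal hR) _)⟩

/-- `Q` is negligible against `2 ^ (n / 4)`. -/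
structure QueryBound (Q n : ℕ) : Prop where
  slope : (Q : ℝ) / √(2 ^ n) ≤ 0.01
  ratio : ((1 + (Q : ℝ) / √(2 ^ n)) / (1 - Q / √(2 ^ n))) ^ Q ≤ 1.01

theorem card_subtype_filter_mem {K K' : Finset (ForIndex n)} (h : K ⊆ K') :
    (Finset.univ.filter fun a : K' => (a : ForIndex n) ∈ K).card = K.card := by
  rw [← Finset.card_map (Function.Embedding.subtype _)]
  congr 1
  ext a
  simp only [Finset.mem_map, Finset.mem_filter, Finset.mem_univ, true_and,
    Function.Embedding.subtype_apply, Subtype.exists, exists_and_left, exists_prop,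
    exists_eq_right_right]
  exact ⟨fun ha => ha.1, fun ha => ⟨ha, h ha⟩⟩

/-- A sign pattern is a cone, so both isotropic Gaussians of the sandwich give it mass exactly
2^{-|K|}, whatever their variance. -/
theorem measure_roundBits_subcube {Q : ℕ} (hQ : QueryBound Q n) {K : Finset (ForIndex n)}
    (hK : K.card ≤ Q) (s : ForIndex n → Bool) :
    gaussianPi (Fin n → Bool) {v | ∀ i ∈ K, roundBits v i = s i} ≤
      ENNReal.ofReal 1.01 * 2⁻¹ ^ K.card ∧
    2⁻¹ ^ K.card ≤ ENNReal.ofReal 1.01 *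
      gaussianPi (Fin n → Bool) {v | ∀ i ∈ K, roundBits v i = s i} := by
  have h1 : (Q : ℝ) / √(2 ^ n) < 1 := hQ.slope.trans_lt (by norm_num)
  have h0 : 0 ≤ (Q : ℝ) / √(2 ^ n) := by positivity
  set P : Finset K := Finset.univ.filter fun a : K => (a : ForIndex n) ∈ K
  have hP : P.card = K.card := card_subtype_filter_mem subset_rfl
  obtain ⟨hu, hl⟩ := forForms_sandwich h1 hK 
    (measurable_one.indicator (measurableSet_signCube P fun a => s a))
  have hset : ∫⁻ v, (signCube P fun a => s a).indicator 1 (fun a : K => (forForms n *ᵥ v) a)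
      ∂gaussianPi (Fin n → Bool) =
      gaussianPi (Fin n → Bool) {v | ∀ i ∈ K, roundBits v i = s i} := by
    rw [← lintegral_indicator_one (measurableSet_roundBits fun z => ∀ i ∈ K, z i = s i)]
    refine lintegral_congr fun v => ?_
    simp [Set.indicator_apply, P, roundBits, signCube]
  rw [hset, lintegral_subcube_gaussianPi P _ (Real.sqrt_pos.2 (by linarith)), hP] at hu hl
  exact ⟨hu.trans (by gcongr; exact hQ.ratio), hl.trans (by gcongr; exact hQ.ratio)⟩

theorem lintegral_subcube_signLoss_le {M : ℝ}
    (hM : ∀ c : ℝ, c ^ 2 ≤ 1.01 →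
      ∫⁻ t, signLoss (c * t) ^ 2 ∂ProbabilityTheory.gaussianReal 0 1 ≤ ENNReal.ofReal M)
    {Q : ℕ} (hQ : QueryBound Q n) {K : Finset (ForIndex n)} (hK : K.card + 2 ≤ Q)
    (s : ForIndex n → Bool) (i j : ForIndex n) :
    ∫⁻ v, {v | ∀ a ∈ K, roundBits v a = s a}.indicator 1 v *
        (signLoss ((forForms n *ᵥ v) i) * signLoss ((forForms n *ᵥ v) j))
        ∂gaussianPi (Fin n → Bool) ≤
      ENNReal.ofReal 1.01 * (2⁻¹ ^ K.card *
        if i = j then ENNReal.ofReal M else ENNReal.ofReal 0.3825 ^ 2) := by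
  have h1 : (Q : ℝ) / √(2 ^ n) < 1 := hQ.slope.trans_lt (by norm_num)
  have h0 : 0 ≤ (Q : ℝ) / √(2 ^ n) := by positivity
  -- The sandwich must cover the forms in `K` together with `i` and `j`, hence the margin of 2.
  obtain ⟨K', hcard, hsub, hi, hj⟩ : ∃ K' : Finset (ForIndex n), K'.card ≤ Q ∧ K ⊆ K' ∧ i ∈ K' ∧
      j ∈ K' := by
    refine ⟨insert i (insert j K), ?_, (Finset.subset_insert _ _).trans (Finset.subset_insert _ _),
      by simp, by simp⟩
    refine (Finset.card_insert_le _ _).trans ?_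
    exact (Nat.succ_le_succ (Finset.card_insert_le _ _)).trans hK
  set P : Finset K' := Finset.univ.filter fun a : K' => (a : ForIndex n) ∈ K
  have hP : P.card = K.card := card_subtype_filter_mem hsub
  obtain ⟨i', hi'⟩ : ∃ i' : K', (i' : ForIndex n) = i := ⟨⟨i, hi⟩, rfl⟩
  obtain ⟨j', hj'⟩ : ∃ j' : K', (j' : ForIndex n) = j := ⟨⟨j, hj⟩, rfl⟩
  obtain ⟨hu, -⟩ := forForms_sandwich h1 hcard
    (F := fun z => (signCube P fun a => s a).indicator 1 z *
      (signLoss (z i') * signLoss (z j')))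
    ((measurable_one.indicator (measurableSet_signCube P fun a => s a)).mul
      ((measurable_signLoss.comp (measurable_pi_apply i')).mul
        (measurable_signLoss.comp (measurable_pi_apply j'))))
  rw [lintegral_subcube_mul_signLoss_mul_signLoss P _ i' j' (Real.sqrt_pos.2 (by linarith)),
    hP] at hu
  refine Eq.trans_le (lintegral_congr fun v => ?_) (hu.trans ?_)
  · have : (∀ a ∈ K, roundBits v a = s a) ↔
        (fun a : K' => (forForms n *ᵥ v) a) ∈ signCube P fun a => s a := by
      simp only [P, signCube, Set.mem_ofPred_eq, Finset.mem_filter, Finset.mem_univ, true_and,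
        Subtype.forall, roundBits]
      exact ⟨fun h a _ ha => h a ha, fun h a ha => h a (hsub ha) ha⟩
    beta_reduce
    rw [hi', hj']
    congr 1
    by_cases hv : v ∈ {v | ∀ a ∈ K, roundBits v a = s a}
    · rw [Set.indicator_of_mem (this.1 hv), Set.indicator_of_mem hv]
      rfl
    · rw [Set.indicator_of_notMem (mt this.2 hv), Set.indicator_of_notMem hv]
  · have hsq : √(1 + (Q : ℝ) / √(2 ^ n)) ^ 2 ≤ 1.01 := by
      rw [Real.sq_sqrt (by linarith)]
      have := hQ.slope
      norm_num at this ⊢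
      linarith
    gcongr
    · exact hQ.ratio
    · have hij : i' = j' ↔ i = j := by rw [Subtype.ext_iff, hi', hj']
      simp only [hij]
      split_ifs
      · exact hM _ hsq
      · gcongr
        exact lintegral_signLoss_le (Real.one_le_sqrt.2 (by linarith)) hsq

/-- Markov's inequality for the square of the total loss. The first moment would leave about 0.83 in
place of 0.69, too much for the final factor 4. -/
theorem measure_subcube_bitForrelation_lt {M : ℝ} (hM0 : 0 ≤ M)
    (hM : ∀ c : ℝ, c ^ 2 ≤ 1.01 →
      ∫⁻ t, signLoss (c * t) ^ 2 ∂ProbabilityTheory.gaussianReal 0 1 ≤ ENNReal.ofReal M)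
    (hn : 400 * M ≤ 2 ^ n)
    {Q : ℕ} (hQ : QueryBound Q n) {K : Finset (ForIndex n)} (hK : K.card + 2 ≤ Q)
    (s : ForIndex n → Bool) :
    gaussianPi (Fin n → Bool)
      {v | (∀ i ∈ K, roundBits v i = s i) ∧ bitForrelation (roundBits v) < 0.07} ≤
      ENNReal.ofReal 0.69 * 2⁻¹ ^ K.card := by
  set E := {v : (Fin n → Bool) → ℝ |
    (∀ i ∈ K, roundBits v i = s i) ∧ bitForrelation (roundBits v) < 0.07}
  have hE : MeasurableSet E :=
    measurableSet_roundBits fun z => (∀ i ∈ K, z i = s i) ∧ bitForrelation z < 0.07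
  have hind : Measurable ({v : (Fin n → Bool) → ℝ | ∀ a ∈ K, roundBits v a = s a}.indicator
      (1 : ((Fin n → Bool) → ℝ) → ℝ≥0∞)) :=
    measurable_one.indicator (measurableSet_roundBits fun z => ∀ i ∈ K, z i = s i)
  have hloss : ∀ a, Measurable fun v : (Fin n → Bool) → ℝ => signLoss ((forForms n *ᵥ v) a) :=
    fun a => measurable_signLoss.comp (measurable_forForms a)
  have hN : (0 : ℝ) < 2 ^ n := by positivity
  have key : ENNReal.ofReal (0.93 * 2 ^ n) ^ 2 * gaussianPi (Fin n → Bool) E ≤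
      ENNReal.ofReal (0.93 * 2 ^ n) ^ 2 * (ENNReal.ofReal 0.69 * 2⁻¹ ^ K.card) := by
    calc _ = ∫⁻ v, ENNReal.ofReal (0.93 * 2 ^ n) ^ 2 * E.indicator 1 v
          ∂gaussianPi (Fin n → Bool) := by
          rw [lintegral_const_mul _ (measurable_one.indicator hE), lintegral_indicator_one hE]
      _ ≤ ∫⁻ v, ∑ i, ∑ j, {v | ∀ a ∈ K, roundBits v a = s a}.indicator 1 v *
          (signLoss ((forForms n *ᵥ v) i) * signLoss ((forForms n *ᵥ v) j))
          ∂gaussianPi (Fin n → Bool) := by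
          refine lintegral_mono fun v => ?_
          by_cases hv : v ∈ E
          · have hv' : v ∈ {v | ∀ a ∈ K, roundBits v a = s a} := hv.1
            simp only [Set.indicator_of_mem hv, Set.indicator_of_mem hv', Pi.one_apply, mul_one,
              one_mul]
            rw [← Finset.sum_mul_sum, ← sq]
            gcongr
            exact le_sum_signLoss hv.2
          · simp [Set.indicator_of_notMem hv]
      _ = ∑ i, ∑ j, ∫⁻ v, {v | ∀ a ∈ K, roundBits v a = s a}.indicator 1 v *
          (signLoss ((forForms n *ᵥ v) i) * signLoss ((forForms n *ᵥ v) j))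
          ∂gaussianPi (Fin n → Bool) := by
          refine (lintegral_finsetSum _ fun i _ => Finset.measurable_sum _ fun j _ =>
            hind.mul ((hloss i).mul (hloss j))).trans (Finset.sum_congr rfl fun i _ => ?_)
          exact lintegral_finsetSum _ fun j _ => hind.mul ((hloss i).mul (hloss j))
      _ ≤ ∑ i : ForIndex n, ∑ j : ForIndex n, ENNReal.ofReal 1.01 * (2⁻¹ ^ K.card *
          (ENNReal.ofReal 0.3825 ^ 2 + if i = j then ENNReal.ofReal M else 0)) := by
          refine Finset.sum_le_sum fun i _ => Finset.sum_le_sum fun j _ =>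
            (lintegral_subcube_signLoss_le hM hQ hK s i j).trans ?_
          gcongr
          split_ifs <;> simp
      _ = ENNReal.ofReal 1.01 * (2⁻¹ ^ K.card * ((2 * 2 ^ n) ^ 2 * ENNReal.ofReal 0.3825 ^ 2 +
          (2 * 2 ^ n) * ENNReal.ofReal M)) := by
          simp only [← Finset.mul_sum, Finset.sum_add_distrib, Finset.sum_const, Finset.sum_ite_eq,
            Finset.mem_univ, if_true, Finset.card_univ, Fintype.card_sum, Fintype.card_fun,
            Fintype.card_bool, Fintype.card_fin, nsmul_eq_mul]
          push_cast
          ring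
      _ = 2⁻¹ ^ K.card * ENNReal.ofReal (1.01 * ((2 * 2 ^ n) ^ 2 * 0.3825 ^ 2 +
          (2 * 2 ^ n) * M)) := by
          rw [ENNReal.ofReal_mul (by norm_num), ENNReal.ofReal_add (by positivity) (by positivity),
            ENNReal.ofReal_mul (by positivity), ENNReal.ofReal_mul (p := 2 * 2 ^ n) (by positivity),
            ENNReal.ofReal_pow (by norm_num), ENNReal.ofReal_pow (by positivity),
            ENNReal.ofReal_mul (by norm_num), ENNReal.ofReal_pow (by norm_num),
            ENNReal.ofReal_ofNat]
          ring
      _ ≤ 2⁻¹ ^ K.card * ENNReal.ofReal ((0.93 * 2 ^ n) ^ 2 * 0.69) := by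
          refine mul_le_mul_right (ENNReal.ofReal_le_ofReal ?_) _
          -- 1.01 · 4 · 0.3825² < 0.592 while 0.93² · 0.69 > 0.596; the hypothesis 400M ≤ N fits the
          -- diagonal term 2.02 MN into the gap.
          generalize (2 : ℝ) ^ n = N at hn hN
          nlinarith [mul_le_mul_of_nonneg_right hn hN.le]
      _ = _ := by
          rw [ENNReal.ofReal_mul (by positivity), ENNReal.ofReal_pow (by positivity)]
          ring
  have hpos : 0 < ENNReal.ofReal (0.93 * 2 ^ n) := ENNReal.ofReal_pos.2 (by positivity)
  exact (ENNReal.mul_le_mul_iff_right (pow_ne_zero 2 hpos.ne') (by finiteness)).1 key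

open Classical in
/-- The law of the rounded Gaussian vector restricted to the inputs of large forrelation. -/
noncomputable def roundedWeight (n : ℕ) (z : ForIndex n → Bool) : ℝ≥0∞ :=
  if 0.07 ≤ bitForrelation z then gaussianPi (Fin n → Bool) {v | roundBits v = z} else 0

theorem sum_roundedWeight (K : Finset (ForIndex n)) (s : ForIndex n → Bool) :
    ∑ z with (∀ i ∈ K, z i = s i), roundedWeight n z = gaussianPi (Fin n → Bool)
      {v | (∀ i ∈ K, roundBits v i = s i) ∧ 0.07 ≤ bitForrelation (roundBits v)} := by
  classical
  unfold roundedWeight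
  rw [← Finset.sum_filter, Finset.filter_filter, ← measure_biUnion_finset]
  · congr 1
    ext v
    simp
  · intro z _ z' _ hzz'
    exact Set.disjoint_left.2 fun v hv hv' => hzz' (hv.symm.trans hv')
  · exact fun z _ => measurableSet_roundBits fun z' => z' = z

theorem sum_roundedWeight_le {Q : ℕ} (hQ : QueryBound Q n) {K : Finset (ForIndex n)}
    (hK : K.card + 2 ≤ Q) (s : ForIndex n → Bool) :
    ∑ z with (∀ i ∈ K, z i = s i), roundedWeight n z ≤ ENNReal.ofReal 1.01 * 2⁻¹ ^ K.card := by
  rw [sum_roundedWeight]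
  exact (measure_mono fun v hv => hv.1).trans (measure_roundBits_subcube hQ (by omega) s).1

/-- The good part has relative mass at least 1/1.01 - 0.69 > 0.29. -/
theorem le_sum_roundedWeight {M : ℝ} (hM0 : 0 ≤ M)
    (hM : ∀ c : ℝ, c ^ 2 ≤ 1.01 →
      ∫⁻ t, signLoss (c * t) ^ 2 ∂ProbabilityTheory.gaussianReal 0 1 ≤ ENNReal.ofReal M)
    (hn : 400 * M ≤ 2 ^ n)
    {Q : ℕ} (hQ : QueryBound Q n) {K : Finset (ForIndex n)} (hK : K.card + 2 ≤ Q)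
    (s : ForIndex n → Bool) :
    ENNReal.ofReal 0.29 * 2⁻¹ ^ K.card ≤ ∑ z with (∀ i ∈ K, z i = s i), roundedWeight n z := by
  rw [sum_roundedWeight]
  have h1 := (measure_roundBits_subcube hQ (K := K) (by omega) s).2
  have h2 := measure_subcube_bitForrelation_lt hM0 hM hn hQ hK s
  set B := {v : (Fin n → Bool) → ℝ |
    (∀ i ∈ K, roundBits v i = s i) ∧ bitForrelation (roundBits v) < 0.07}
  set G := {v : (Fin n → Bool) → ℝ |
    (∀ i ∈ K, roundBits v i = s i) ∧ 0.07 ≤ bitForrelation (roundBits v)}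
  have h3 : gaussianPi (Fin n → Bool) {v | ∀ i ∈ K, roundBits v i = s i} ≤
      gaussianPi (Fin n → Bool) G + gaussianPi (Fin n → Bool) B := by
    refine (measure_mono fun v hv => ?_).trans (measure_union_le G B)
    rcases le_or_gt 0.07 (bitForrelation (roundBits v)) with h | h
    · exact Or.inl ⟨hv, h⟩
    · exact Or.inr ⟨hv, h⟩
  have h4 : (2⁻¹ : ℝ≥0∞) ^ K.card ≤ ENNReal.ofReal 1.01 * (gaussianPi (Fin n → Bool) G +
      ENNReal.ofReal 0.69 * 2⁻¹ ^ K.card) := h1.trans (by gcongr; exact h3.trans (by gcongr))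
  have hfin : gaussianPi (Fin n → Bool) G ≠ ∞ := measure_ne_top _ _
  lift gaussianPi (Fin n → Bool) G to NNReal using hfin with g
  have h5 := ENNReal.toReal_mono (by finiteness) h4
  rw [← ENNReal.toReal_le_toReal (by finiteness) (by finiteness)]
  rw [ENNReal.toReal_mul, ENNReal.toReal_add (by finiteness) (by finiteness),
    ENNReal.toReal_mul, ENNReal.toReal_ofReal (by norm_num),
    ENNReal.toReal_ofReal (by norm_num)] at h5
  rw [ENNReal.toReal_mul, ENNReal.toReal_ofReal (by norm_num)]
  have h6 : 0 ≤ ((2⁻¹ : ℝ≥0∞) ^ K.card).toReal := ENNReal.toReal_nonneg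
  norm_num at h5 h6 ⊢
  linarith

end GaussianRounding

/-! ### Polynomial query bounds are eventually small enough -/

section Asymptotics

open Filter Topology

theorem tendsto_polynomial_div_sqrt_two_pow (p : Polynomial ℕ) :
    Tendsto (fun n : ℕ => ((p.eval n : ℕ) : ℝ) / √(2 ^ n)) atTop (𝓝 0) := by
  set c : ℝ := Real.log 2 / 2 with hc
  have hc0 : 0 < c := by have := Real.log_pos one_lt_two; positivity
  have h := ((p.map (Nat.castRingHom ℝ)).comp
    (Polynomial.C c⁻¹ * Polynomial.X)).tendsto_div_exp_atTop.comp
    (tendsto_natCast_atTop_atTop.atTop_mul_const hc0)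
  refine h.congr fun n => ?_
  have h1 : Real.exp (n * c) = √(2 ^ n) := by
    rw [Real.sqrt_eq_rpow, ← Real.rpow_natCast, ← Real.rpow_mul zero_le_two,
      Real.rpow_def_of_pos zero_lt_two, hc]
    ring_nf
  have h2 : c⁻¹ * (n * c) = n := by field_simp
  simp only [Function.comp_apply, h1, Polynomial.eval_comp, Polynomial.eval_mul, Polynomial.eval_C,
    Polynomial.eval_X, h2]
  rw [Polynomial.eval_natCast_map]
  rfl

/-- Since (1+ε)/(1-ε) ≤ exp(3ε) for small ε, the Q-th power is governed by εQ = Q²/√N. -/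
theorem QueryBound.of_sq_div_le {Q n : ℕ} (hQ : 1 ≤ Q) (h : (Q : ℝ) ^ 2 / √(2 ^ n) ≤ 0.001) :
    QueryBound Q n := by
  have hs : 0 < √((2 : ℝ) ^ n) := by positivity
  have hQ' : (1 : ℝ) ≤ Q := by exact_mod_cast hQ
  set ε : ℝ := Q / √(2 ^ n) with hε
  have h0 : 0 ≤ ε := by positivity
  have h1 : ε * Q ≤ 0.001 := by
    rw [hε, div_mul_eq_mul_div, ← sq]
    exact h
  have h2 : ε ≤ 0.001 := by nlinarith
  refine ⟨h2.trans (by norm_num), ?_⟩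
  have h3 : (1 + ε) / (1 - ε) ≤ Real.exp (3 * ε) := by
    refine le_trans ?_ (Real.add_one_le_exp _)
    rw [div_le_iff₀ (by norm_num at h2; linarith)]
    norm_num at h2
    nlinarith
  calc ((1 + ε) / (1 - ε)) ^ Q ≤ Real.exp (3 * ε) ^ Q := by
        gcongr
        exact div_nonneg (by linarith) (by norm_num at h2; linarith)
    _ = Real.exp (3 * (ε * Q)) := by rw [← Real.exp_nat_mul]; ring_nf
    -- This exponent is at most log 1.01, by log x ≥ 1 - 1/x.
    _ ≤ Real.exp (1 - 1.01⁻¹) := by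
        gcongr
        norm_num at h1 ⊢
        linarith
    _ ≤ 1.01 := by
        have := Real.one_sub_inv_le_log_of_pos (x := 1.01) (by norm_num)
        rwa [← Real.le_log_iff_exp_le (by norm_num)]

theorem two_mul_sqrt_le {q Q n : ℕ} (hq : q ≤ Q) (hQ : 1 ≤ Q) (hN : 4000000 ≤ (2 : ℝ) ^ n)
    (h : (Q : ℝ) ^ 2 / √(2 ^ n) ≤ 0.001) :
    2 * √(4 * q * 2 ^ n) ≤ 0.005 * 2 ^ n := by
  have hs : 0 < √((2 : ℝ) ^ n) := by positivity
  have hss : √((2 : ℝ) ^ n) * √(2 ^ n) = 2 ^ n := Real.mul_self_sqrt (by positivity)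
  have hs' : 2000 ≤ √((2 : ℝ) ^ n) := Real.le_sqrt_of_sq_le (by norm_num; linarith)
  rw [div_le_iff₀ hs] at h
  have hQ' : (1 : ℝ) ≤ Q := by exact_mod_cast hQ
  have hq' : (q : ℝ) ≤ Q := by exact_mod_cast hq
  generalize √((2 : ℝ) ^ n) = r at *
  have h1 : √(4 * q * 2 ^ n) ≤ 0.0025 * 2 ^ n := by
    rw [Real.sqrt_le_left (by positivity)]
    have h2 : (q : ℝ) ≤ 0.001 * r := by nlinarith
    have h3 : 0.001 * r ≤ 0.0000015 * 2 ^ n := by nlinarith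
    generalize (2 : ℝ) ^ n = N at *
    norm_num at h2 h3 hN ⊢
    nlinarith
  linarith

end Asymptotics

/-! ### The lower bound -/

theorem mainTheorem2 (p : Polynomial ℕ) :
    ∀ᶠ n : ℕ in Filter.atTop,
      ¬ ∃ A : BPPPathAlgorithm (ForIndex n), A.MakesAtMost (p.eval n) ∧ A.Computes (For n) := by
  classical
  obtain ⟨M, hM0, hM⟩ := exists_lintegral_signLoss_sq_le
  -- The 2 makes room for the two extra forms of the second moment; the square is what the Q-th
  -- power of the sandwich ratio requires.
  have hpoly := tendsto_polynomial_div_sqrt_two_pow ((p + 2) ^ 2)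
  have hpow := tendsto_pow_atTop_atTop_of_one_lt (one_lt_two (α := ℝ))
  filter_upwards [hpoly.eventually (eventually_le_nhds (show (0 : ℝ) < 0.001 by norm_num)),
    hpow.eventually_ge_atTop (400 * M), hpow.eventually_ge_atTop 4000000] with n hn hnM hN
  rintro ⟨A, hA, hAF⟩
  have hev : ((p + 2) ^ 2).eval n = (p.eval n + 2) ^ 2 := by simp
  rw [hev, Nat.cast_pow] at hn
  have hQ := QueryBound.of_sq_div_le (by omega) hn
  have hq := two_mul_sqrt_le (Nat.le_add_right (p.eval n) 2) (by omega) hN hn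
  refine BPPPathAlgorithm.not_computes_of_subcube_ratio hA (w₀ := uniformWeight n)
    (w₁ := roundedWeight n) (c₁ := ENNReal.ofReal 0.29) (c₂ := ENNReal.ofReal 1.03) ?_ ?_ ?_
    ENNReal.ofReal_ne_top ?_ ?_ ?_ ?_ hAF
  · intro z hz
    by_contra h
    exact hz (if_neg (mt For_eq_some_false h))
  · intro z hz
    by_contra h
    exact hz (if_neg (mt For_eq_some_true h))
  · rw [← ENNReal.ofReal_ofNat, ← ENNReal.ofReal_mul (by norm_num),
      ENNReal.ofReal_lt_ofReal_iff (by norm_num)]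
    norm_num
  · intro K hK s
    refine le_trans ?_ (le_sum_roundedWeight hM0 hM hnM hQ (by omega) s)
    gcongr
    exact sum_uniformWeight_le K s
  · intro K hK s
    refine (sum_roundedWeight_le hQ (by omega) s).trans ?_
    -- The choice `c₂ = 1.03` works because 1.01 ≤ 1.03 · 0.99.
    refine le_trans ?_ (mul_le_mul_right (le_sum_uniformWeight hN hq hK s) _)
    rw [← mul_assoc, ← ENNReal.ofReal_mul (by norm_num)]
    gcongr
    norm_num
  · have h := le_sum_uniformWeight hN hq (K := ∅) (by simp) fun _ => true
    simp only [Finset.notMem_empty, false_imp_iff, implies_true, Finset.filter_true,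
      Finset.card_empty, pow_zero, mul_one] at h
    exact ((ENNReal.ofReal_pos.2 (by norm_num)).trans_le h).ne'
  · have h := sum_uniformWeight_le (n := n) ∅ fun _ => true
    simp only [Finset.notMem_empty, false_imp_iff, implies_true, Finset.filter_true,
      Finset.card_empty, pow_zero] at h
    exact ne_top_of_le_ne_top ENNReal.one_ne_top h
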